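/- Let $k$ be a field of characteristic $p>0$ and let $X$ be a normal variety over $k$ (a normal integral separated scheme of finite type over $k$) which is $F$-finite, i.e. whose absolute Frobenius morphism $F\colon X\to X$ is finite. Let $\Delta\ge 0$ be an effective Weil $\mathbb{Q}$-divisor on $X$. (It is not required that $K_X+\Delta$ be $\mathbb{Q}$-Cartier.) The pair $(X,\Delta)$ is called *globally $F$-regular* if for every effective Weil divisor $D\ge 0$ on $X$ there is an integer $e>0$ such that the natural map $\mathcal{O}_X\to F^e_*\mathcal{O}_X(\lceil (p^e-1)\Delta\rceil+D)$ splits as a map of $\mathcal{O}_X$-modules. For an effective Weil $\mathbb{Q}$-divisor $\Gamma\ge 0$, the pair $(X,\Gamma)$ is called *globally $+$-regular* if for every finite dominant morphism $f\colon Y\to X$ from a normal integral scheme $Y$, the natural map $\mathcal{O}_X\to f_*\mathcal{O}_Y(\lfloor f^*\Gamma\rfloor)$ splits as a map of $\mathcal{O}_X$-modules. The pair $(X,\Delta)$ is called *strongly globally $+$-regular* if for every effective Weil divisor $D\ge 0$ on $X$ there is a rational number $\epsilon>0$ such that $(X,\Delta+\epsilon D)$ is globally $+$-regular. Then $(X,\Delta)$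 is globally $F$-regular if and only if it is strongly globally $+$-regular. -/

import Mathlib

open CategoryTheory TopologicalSpace Opposite AlgebraicGeometry

universe u

noncomputable section

namespace PlusRegular

/-! ### Normal schemes and prime divisors -/

/-- A scheme is normal if all its local rings are integrally closed domains. -/
class IsNormalScheme (X : Scheme.{u}) : Prop where
  isDomain_stalk : ∀ x : X, IsDomain (X.presheaf.stalk x)
  isIntegrallyClosed_stalk : ∀ x : X, IsIntegrallyClosed (X.presheaf.stalk x)

/-- Prime divisors, given by their generic points: the points of codimension one.
(In the order on `X`, the generic point is the largest element, so that `Order.coheight x` is the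
codimension of the closure of `x`, i.e. the dimension of the local ring at `x`.) -/
def PrimeDivisor (X : Scheme.{u}) : Type u := {x : X // Order.coheight x = 1}

/-- Weil divisors with integral coefficients (on a Noetherian scheme). -/
abbrev WeilDivisor (X : Scheme.{u}) : Type u := PrimeDivisor X →₀ ℤ

/-- Weil divisors with rational coefficients (on a Noetherian scheme). -/
abbrev QDivisor (X : Scheme.{u}) : Type u := PrimeDivisor X →₀ ℚ

variable {X Y : Scheme.{u}}

/-- An integral Weil divisor regarded as a `ℚ`-divisor. -/
def WeilDivisor.toQ (D : WeilDivisor X) : QDivisor X :=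
  D.mapRange (fun n : ℤ => (n : ℚ)) Int.cast_zero

/-- The round-down `⌊Δ⌋`, coefficient by coefficient. -/
def QDivisor.floor (Δ : QDivisor X) : WeilDivisor X :=
  Δ.mapRange (fun q : ℚ => ⌊q⌋) Int.floor_zero

/-- The round-up `⌈Δ⌉`, coefficient by coefficient. -/
def QDivisor.ceil (Δ : QDivisor X) : WeilDivisor X :=
  Δ.mapRange (fun q : ℚ => ⌈q⌉) Int.ceil_zero

/-! ### Pullback of divisors -/

/-- The ramification index of `f : Y ⟶ X` at `y`: the length of `𝒪_{Y,y} / 𝔪_{f y} 𝒪_{Y,y}`. When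
both local rings are discrete valuation rings, it is the order of vanishing at `y` of the pullback
of a local equation of the prime divisor `f y`. -/
def ramificationIndex (f : Y ⟶ X) (y : Y) : ℕ :=
  (Module.length (Y.presheaf.stalk y)
    (Y.presheaf.stalk y ⧸
      (IsLocalRing.maximalIdeal (X.presheaf.stalk (f y))).map (f.stalkMap y).hom)).toNat

open Classical in
/-- The coefficient of `f^*Δ` along the prime divisor `y`. -/
def pullbackCoeff (f : Y ⟶ X) (Δ : QDivisor X) (y : PrimeDivisor Y) : ℚ :=
  if h : Order.coheight (f y.1) = 1 then ramificationIndex f y.1 * Δ ⟨f y.1, h⟩ else 0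

/-- The pullback `f^*Δ` of a `ℚ`-divisor under a finite morphism: the coefficient of a prime divisor
of `Y` is the coefficient of its image in `X`, multiplied by the ramification index. -/
def QDivisor.pullback (f : Y ⟶ X) [IsFinite f] (Δ : QDivisor X) : QDivisor Y :=
  Finsupp.ofSupportFinite (pullbackCoeff f Δ) (by
    have hfin : {y : Y | f y ∈ Subtype.val '' (Δ.support : Set (PrimeDivisor X))}.Finite :=
      f.finite_preimage ((Δ.support.finite_toSet).image _)
    refine Set.Finite.subset (hfin.preimage (f := fun y : PrimeDivisor Y => y.1)
      (Subtype.val_injective.injOn)) ?_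
    intro y hy
    rw [Function.mem_support, pullbackCoeff] at hy
    split_ifs at hy with h
    · exact ⟨⟨f y.1, h⟩, Finsupp.mem_support_iff.2 (right_ne_zero_of_mul hy), rfl⟩
    · exact absurd rfl hy)

/-! ### The sheaf `𝒪_X(D)` -/

/-- The structure sheaf `𝒪_X` as an `𝒪_X`-module. -/
def structureSheaf (X : Scheme.{u}) : X.Modules := SheafOfModules.unit X.ringCatSheaf

section SheafOfDivisor

variable [IsIntegral X]

/-- The image in the function field `K(X)` of the germ of a function on `U`, at each point of `U`. -/
def germsInFunctionField (U : X.Opens) : Γ(X, U) →+* (U → X.functionField) :=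
  RingHom.pi fun x =>
    (algebraMap (X.presheaf.stalk x.1) X.functionField).comp (X.presheaf.germ U x.1 x.2).hom

theorem germsInFunctionField_const (U : X.Opens) (r : Γ(X, U)) (x y : U) :
    germsInFunctionField U r x = germsInFunctionField U r y := by
  have : Nonempty U := ⟨x⟩
  change algebraMap _ _ (X.presheaf.germ U x.1 x.2 r) = algebraMap _ _ (X.presheaf.germ U y.1 y.2 r)
  rw [Scheme.algebraMap_germ_eq_germToFunctionField, Scheme.algebraMap_germ_eq_germToFunctionField]

theorem germsInFunctionField_res {U V : X.Opens} (i : V ⟶ U) (r : Γ(X, U)) (x : V) :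
    germsInFunctionField V (X.presheaf.map i.op r) x = germsInFunctionField U r (i x) := by
  change algebraMap _ _ (X.presheaf.germ V x.1 x.2 (X.presheaf.map i.op r)) =
    algebraMap _ _ (X.presheaf.germ U x.1 (i.le x.2) r)
  rw [TopCat.Presheaf.germ_res_apply]

variable [IsLocallyNoetherian X]

theorem isDiscreteValuationRing_stalk [IsNormalScheme X] {x : X} (hx : Order.coheight x = 1) :
    IsDiscreteValuationRing (X.presheaf.stalk x) := by
  have h1 : IsIntegrallyClosed (X.presheaf.stalk x) := IsNormalScheme.isIntegrallyClosed_stalk x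
  have hdim := ringKrullDim_stalk_eq_coheight x
  rw [hx] at hdim
  have hle : Ring.KrullDimLE 1 (X.presheaf.stalk x) := krullDimLE_of_coheight_le hx.le
  have hnf : ¬ IsField (X.presheaf.stalk x) := by
    intro hf
    rw [ringKrullDim_eq_zero_of_isField hf] at hdim
    exact absurd hdim (by decide)
  have hd : IsDedekindDomain (X.presheaf.stalk x) :=
    { toIsDomain := inferInstance
      toIsDedekindRing :=
        { toIsNoetherian := inferInstance
          toDimensionLEOne :=
            ⟨fun {I} hI hp => Ring.krullDimLE_one_iff_of_noZeroDivisors.1 hle I hI hp⟩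
          toIsIntegralClosure := inferInstance } }
  exact ((IsDiscreteValuationRing.TFAE _ hnf).out 0 2).2 hd

/-- The condition on a function `s : U → K(X)` to be a section of `𝒪_X(D)`: it is constant, and its
value `φ` satisfies `φ = 0` or `ord_P φ + D(P) ≥ 0` for every prime divisor `P` meeting `U`. If `U` is
not empty, then such an `s` is the same as an element `φ` of `K(X)` with this property; if `U` is
empty, then there is exactly one such `s`. -/
def IsSectionOfDivisor (D : WeilDivisor X) {U : X.Opens} (s : U → X.functionField) : Prop :=
  (∀ x y : U, s x = s y) ∧
    ∀ (P : PrimeDivisor X) (hP : P.1 ∈ U), s ⟨P.1, hP⟩ = 0 ∨ 0 ≤ X.ord (s ⟨P.1, hP⟩) P.1 + D P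

/-- Sections of `𝒪_X(D)` over `U`. -/
def DivisorSections (D : WeilDivisor X) (U : X.Opens) : Type u :=
  {s : U → X.functionField // IsSectionOfDivisor D s}

theorem IsSectionOfDivisor.smul {D : WeilDivisor X} {U : X.Opens} (r : Γ(X, U))
    {s : U → X.functionField} (hs : IsSectionOfDivisor D s) :
    IsSectionOfDivisor D (germsInFunctionField U r * s) := by
  refine ⟨fun x y => ?_, fun P hP => ?_⟩
  · rw [Pi.mul_apply, Pi.mul_apply, germsInFunctionField_const U r x y, hs.1 x y]
  · have : Nonempty U := ⟨⟨P.1, hP⟩⟩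
    rcases hs.2 P hP with h | h
    · left
      rw [Pi.mul_apply, h, mul_zero]
    · by_cases hr : r = 0
      · left
        rw [hr, map_zero, zero_mul, Pi.zero_apply]
      · right
        have h2 : germsInFunctionField U r ⟨P.1, hP⟩ = X.germToFunctionField U r :=
          Scheme.algebraMap_germ_eq_germToFunctionField X hP r
        have h3 := Scheme.ord_le_smul hP hr (s ⟨P.1, hP⟩)
        rw [Algebra.smul_def] at h3
        rw [Pi.mul_apply, h2]
        exact h.trans (by gcongr; exact h3)

theorem IsSectionOfDivisor.zero (D : WeilDivisor X) (U : X.Opens) :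
    IsSectionOfDivisor D (0 : U → X.functionField) :=
  ⟨fun _ _ => rfl, fun _ _ => Or.inl rfl⟩

theorem IsSectionOfDivisor.neg {D : WeilDivisor X} {U : X.Opens}
    {s : U → X.functionField} (hs : IsSectionOfDivisor D s) : IsSectionOfDivisor D (-s) := by
  have h := hs.smul (-1 : Γ(X, U))
  rwa [map_neg, map_one, neg_one_mul] at h

theorem IsSectionOfDivisor.add [IsNormalScheme X] {D : WeilDivisor X} {U : X.Opens}
    {s t : U → X.functionField} (hs : IsSectionOfDivisor D s) (ht : IsSectionOfDivisor D t) :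
    IsSectionOfDivisor D (s + t) := by
  refine ⟨fun x y => ?_, fun P hP => ?_⟩
  · rw [Pi.add_apply, Pi.add_apply, hs.1 x y, ht.1 x y]
  · have := isDiscreteValuationRing_stalk P.2
    rw [Pi.add_apply]
    by_cases h0 : s ⟨P.1, hP⟩ + t ⟨P.1, hP⟩ = 0
    · exact Or.inl h0
    · rcases hs.2 P hP with h | h
      · rw [h, zero_add]
        exact ht.2 P hP
      · rcases ht.2 P hP with h' | h'
        · rw [h', add_zero]
          exact Or.inr h
        · right
          have h4 := Scheme.ord_add (x := P.1) h0
          rcases min_le_iff.1 h4 with h5 | h5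
          · exact h.trans (by gcongr)
          · exact h'.trans (by gcongr)

/-- Being a section of `𝒪_X(D)` is a local condition. -/
def divisorPredicate (D : WeilDivisor X) :
    TopCat.LocalPredicate (X := X.carrier) (fun _ => X.functionField) where
  pred {U} s := IsSectionOfDivisor D (U := U) s
  res i _ hs := ⟨fun x y => hs.1 (i x) (i y), fun P hP => hs.2 P (i.le hP)⟩
  locality {U} s hs := by
    refine ⟨fun x y => ?_, fun P hP => ?_⟩
    · obtain ⟨V, hxV, i, hV⟩ := hs x
      obtain ⟨W, hyW, j, hW⟩ := hs y
      obtain ⟨z, -, hzV, hzW⟩ := (PreirreducibleSpace.isPreirreducible_univ (X := X))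
        V W V.isOpen W.isOpen ⟨x, trivial, hxV⟩ ⟨y, trivial, hyW⟩
      exact (hV.1 ⟨x, hxV⟩ ⟨z, hzV⟩).trans (hW.1 ⟨z, hzW⟩ ⟨y, hyW⟩)
    · obtain ⟨V, hxV, i, hV⟩ := hs ⟨P.1, hP⟩
      exact hV.2 P hxV

/-- For `D ≥ 0`, the image of a function in `K(X)` is a section of `𝒪_X(D)`. -/
theorem isSectionOfDivisor_germs {D : WeilDivisor X} (hD : 0 ≤ D) (U : X.Opens) (r : Γ(X, U)) :
    IsSectionOfDivisor D (germsInFunctionField U r) := by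
  have h1 : IsSectionOfDivisor D (1 : U → X.functionField) := by
    refine ⟨fun _ _ => rfl, fun P hP => Or.inr ?_⟩
    have : Nonempty U := ⟨⟨P.1, hP⟩⟩
    have h := Scheme.ord_of_isUnit (X := X) (f := (1 : Γ(X, U))) isUnit_one hP
    rw [map_one] at h
    rw [Pi.one_apply, h, zero_add]
    exact hD P
  have h2 := h1.smul r
  rwa [mul_one] at h2

variable [IsNormalScheme X]

instance (D : WeilDivisor X) (U : X.Opens) : AddCommGroup (DivisorSections D U) :=
  inferInstanceAs (AddCommGroup
    ({ carrier := {s | IsSectionOfDivisor D s}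
       add_mem' := IsSectionOfDivisor.add
       zero_mem' := IsSectionOfDivisor.zero D U
       neg_mem' := IsSectionOfDivisor.neg } : AddSubgroup (U → X.functionField)))

instance (D : WeilDivisor X) (U : X.Opens) : Module Γ(X, U) (DivisorSections D U) where
  smul r s := ⟨germsInFunctionField U r * s.1, s.2.smul r⟩
  one_smul s := Subtype.ext ((congrArg (· * s.1) (map_one _)).trans (one_mul _))
  mul_smul r r' s := Subtype.ext
    ((congrArg (· * s.1) (map_mul (germsInFunctionField U) r r')).trans (mul_assoc _ _ _))
  smul_zero _ := Subtype.ext (mul_zero _)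
  smul_add _ _ _ := Subtype.ext (mul_add _ _ _)
  add_smul r r' s := Subtype.ext
    ((congrArg (· * s.1) (map_add (germsInFunctionField U) r r')).trans (add_mul _ _ _))
  zero_smul s := Subtype.ext ((congrArg (· * s.1) (map_zero _)).trans (zero_mul _))

/-- The presheaf of abelian groups underlying `𝒪_X(D)`: restriction is restriction of functions. -/
def divisorPresheaf (D : WeilDivisor X) : (X.Opens)ᵒᵖ ⥤ Ab.{u} where
  obj U := AddCommGrpCat.of (DivisorSections D U.unop)
  map {U V} i := AddCommGrpCat.ofHom
    { toFun := fun s => ⟨fun x => s.1 (i.unop x), (divisorPredicate D).res i.unop s.1 s.2⟩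
      map_zero' := rfl
      map_add' := fun _ _ => rfl }

instance (D : WeilDivisor X) (U : (X.Opens)ᵒᵖ) :
    Module (X.ringCatSheaf.obj.obj U) ((divisorPresheaf D).obj U) :=
  inferInstanceAs (Module Γ(X, U.unop) (DivisorSections D U.unop))

/-- The sheaf of `𝒪_X`-modules `𝒪_X(D)` of a Weil divisor `D` on a normal integral scheme: a
subsheaf of the constant sheaf of rational functions. -/
def sheafOfDivisor (D : WeilDivisor X) : X.Modules where
  val := PresheafOfModules.ofPresheaf (R := X.ringCatSheaf.obj) (divisorPresheaf D) (by
    intro U V i r s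
    refine Subtype.ext (funext fun x => ?_)
    exact congrArg (· * s.1 (i.unop x)) (germsInFunctionField_res i.unop r x).symm)
  isSheaf := by
    change TopCat.Presheaf.IsSheaf (X := X.carrier) (divisorPresheaf D)
    rw [TopCat.Presheaf.isSheaf_iff_isSheaf_comp (forget Ab.{u})]
    exact TopCat.subpresheafToTypes.isSheaf (divisorPredicate D)

/-- The inclusion `𝒪_X ⟶ 𝒪_X(D)` for an effective Weil divisor `D`. -/
def structureSheafToSheafOfDivisor (D : WeilDivisor X) (hD : 0 ≤ D) :
    structureSheaf X ⟶ sheafOfDivisor D where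
  val :=
    { app := fun U => ModuleCat.ofHom (R := Γ(X, U.unop)) (X := Γ(X, U.unop))
        (Y := DivisorSections D U.unop)
        { toFun := fun r => ⟨germsInFunctionField U.unop r, isSectionOfDivisor_germs hD U.unop r⟩
          map_add' := fun r r' => Subtype.ext (map_add _ r r')
          map_smul' := fun r r' => Subtype.ext (map_mul _ r r') }
      naturality := by
        intro U V i
        refine ModuleCat.hom_ext (LinearMap.ext fun r => ?_)
        exact Subtype.ext (funext fun x => germsInFunctionField_res i.unop r x) }

end SheafOfDivisor

section Splitting

variable [IsIntegral Y] [IsLocallyNoetherian Y] [IsNormalScheme Y]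

/-- The natural map of `𝒪_X`-modules `𝒪_X ⟶ f_*𝒪_Y ⟶ f_*(𝒪_Y(E))` for a morphism `f : Y ⟶ X` and an
effective Weil divisor `E` on `Y`. -/
def naturalMap (f : Y ⟶ X) (E : WeilDivisor Y) (hE : 0 ≤ E) :
    structureSheaf X ⟶
      (Scheme.Modules.pushforward f).obj (sheafOfDivisor E) :=
  SheafOfModules.unitToPushforwardObjUnit f.toRingCatSheafHom ≫
    (Scheme.Modules.pushforward f).map (structureSheafToSheafOfDivisor E hE)

/-- `E` is effective and the natural map `𝒪_X ⟶ f_*(𝒪_Y(E))` splits as a map of `𝒪_X`-modules, i.e.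
it has a left inverse. -/
def NaturalMapSplits (f : Y ⟶ X) (E : WeilDivisor Y) : Prop :=
  ∃ hE : 0 ≤ E, IsSplitMono (naturalMap f E hE)

end Splitting

/-! ### Global `+`-regularity -/

section GloballyPlusRegular

variable [IsIntegral X] [IsLocallyNoetherian X] [IsNormalScheme X]

/-- `(X, Δ)` is globally `+`-regular if `𝒪_X ⟶ f_*𝒪_Y(⌊f^*Δ⌋)` splits for every finite dominant
morphism `f : Y ⟶ X` with `Y` normal (and integral). Such a `Y` is automatically locally
Noetherian. -/
def IsGloballyPlusRegular (Δ : QDivisor X) : Prop :=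
  ∀ (Y : Scheme.{u}) [IsIntegral Y] [IsLocallyNoetherian Y] [IsNormalScheme Y]
    (f : Y ⟶ X) [IsFinite f] [IsDominant f],
    NaturalMapSplits f (QDivisor.floor (QDivisor.pullback f Δ))

/-- `(X, Δ)` is strongly globally `+`-regular if for every effective divisor `D` there is `ε > 0`
such that `(X, Δ + ε D)` is globally `+`-regular. -/
def IsStronglyGloballyPlusRegular (Δ : QDivisor X) : Prop :=
  ∀ D : WeilDivisor X, 0 ≤ D → ∃ ε : ℚ, 0 < ε ∧ IsGloballyPlusRegular (Δ + ε • D.toQ)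

end GloballyPlusRegular

/-! ### Frobenius and global `F`-regularity -/

/-- `X` has characteristic `p`, i.e. `p = 0` in `𝒪_X`. -/
def HasCharP (X : Scheme.{u}) (p : ℕ) : Prop := (p : Γ(X, ⊤)) = 0

theorem HasCharP.natCast_eq_zero {p : ℕ} (hX : HasCharP X p) (U : X.Opens) :
    (p : Γ(X, U)) = 0 := by
  have h := congrArg (X.presheaf.map (homOfLE le_top : U ⟶ ⊤).op) hX
  rwa [map_natCast, map_zero] at h

/-- A scheme over a field of characteristic `p` has characteristic `p`. -/
theorem HasCharP.of_hom_spec {k : Type u} [Field k] (p : ℕ) [CharP k p]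
    (s : X ⟶ Spec (CommRingCat.of k)) : HasCharP X p := by
  have h := congrArg ((Scheme.ΓSpecIso (CommRingCat.of k)).inv ≫ s.appTop) (CharP.cast_eq_zero k p)
  rwa [map_natCast, map_zero] at h

theorem add_pow_of_natCast_eq_zero {R : Type u} [CommRing R] {p : ℕ} [hp : Fact p.Prime]
    (h : (p : R) = 0) (e : ℕ) (a b : R) : (a + b) ^ p ^ e = a ^ p ^ e + b ^ p ^ e := by
  cases subsingleton_or_nontrivial R
  · exact Subsingleton.elim _ _
  · have : CharP R p := (CharP.charP_iff_prime_eq_zero hp.out).2 h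
    exact add_pow_char_pow a b p e

/-- The ring homomorphism `a ↦ a ^ (p ^ e)` of a ring in which the prime `p` is zero. -/
def frobeniusRingHom {R : Type u} [CommRing R] (p : ℕ) [hp : Fact p.Prime]
    (h : (p : R) = 0) (e : ℕ) : R →+* R where
  toFun a := a ^ p ^ e
  map_one' := one_pow _
  map_mul' a b := mul_pow a b _
  map_zero' := zero_pow (pow_ne_zero e hp.out.ne_zero)
  map_add' a b := add_pow_of_natCast_eq_zero h e a b

/-- The `e`-th iterate `F^e : X ⟶ X` of the absolute Frobenius as a morphism of ringed spaces. -/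
def frobeniusPresheafedSpaceHom (p : ℕ) [Fact p.Prime] (hX : HasCharP X p) (e : ℕ) :
    X.toPresheafedSpace.Hom X.toPresheafedSpace where
  base := 𝟙 _
  c :=
    { app := fun U => CommRingCat.ofHom (R := Γ(X, U.unop)) (S := Γ(X, U.unop))
        (frobeniusRingHom p (hX.natCast_eq_zero U.unop) e)
      naturality := by
        intro U V i
        ext r
        exact (map_pow (X.presheaf.map i).hom r (p ^ e)).symm }

/-- The `e`-th iterate `F^e : X ⟶ X` of the absolute Frobenius morphism of a scheme of
characteristic `p`: the identity on points, and `a ↦ a ^ (p ^ e)` on functions. -/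
def absoluteFrobenius (p : ℕ) [hp : Fact p.Prime] (hX : HasCharP X p) (e : ℕ) : X ⟶ X where
  toHom := frobeniusPresheafedSpaceHom p hX e
  prop x := by
    refine ⟨fun a ha => ?_⟩
    obtain ⟨U, hxU, r, rfl⟩ := X.presheaf.exists_germ_eq a
    have h1 : (frobeniusPresheafedSpaceHom p hX e).stalkMap x (X.presheaf.germ U x hxU r) =
        (X.presheaf.germ U x hxU r) ^ p ^ e := by
      refine (PresheafedSpace.stalkMap_germ_apply (frobeniusPresheafedSpaceHom p hX e) U x hxU r).trans
        ?_
      exact map_pow (X.presheaf.germ U x hxU).hom r (p ^ e)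
    have h2 := ha
    erw [h1] at h2
    exact (isUnit_pow_iff (pow_ne_zero e hp.out.ne_zero)).1 h2

/-- A scheme of characteristic `p` is `F`-finite if its absolute Frobenius morphism is finite. -/
def IsFFinite (p : ℕ) [Fact p.Prime] (hX : HasCharP X p) : Prop :=
  IsFinite (absoluteFrobenius p hX 1)

/-- `(X, Δ)` is globally `F`-regular if for every effective divisor `D` there is `e > 0` such that
`𝒪_X ⟶ F^e_*𝒪_X(⌈(p^e - 1)Δ⌉ + D)` splits. -/
def IsGloballyFRegular [IsIntegral X] [IsLocallyNoetherian X] [IsNormalScheme X]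
    (p : ℕ) [Fact p.Prime] (hX : HasCharP X p) (Δ : QDivisor X) : Prop :=
  ∀ D : WeilDivisor X, 0 ≤ D → ∃ e : ℕ, 0 < e ∧
    NaturalMapSplits (absoluteFrobenius p hX e)
      (QDivisor.ceil (((p : ℚ) ^ e - 1) • Δ) + D)

end PlusRegular

end

noncomputable section

namespace PlusRegular

variable {X Y Z : Scheme.{u}}

/-! ### Rational functions with bounded poles -/

/-! Every $\mathcal{O}_X$-linear map used here is induced by an additive map of function fields that
respects pole bounds at prime divisors. By `NaturalMapSplits.of_transfer`, if such a map fixes $1$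
and carries $f_*\mathcal{O}_Y(E)$ into $g_*\mathcal{O}_Z(E')$, then a splitting for $(g,E')$ yields
one for $(f,E)$.

From $+$ to $F$: by $F$-finiteness $F^e$ is a finite cover of $X$ by $X$, and it multiplies divisors
by $p^e$. Apply strong $+$-regularity to $D+\lceil\Delta\rceil$ and take $p^e\epsilon\ge 1$. The
pullback of $\Delta+\epsilon(D+\lceil\Delta\rceil)$ then dominates $\lceil(p^e-1)\Delta\rceil+D$,
and a splitting for a larger divisor restricts to one for a smaller.

From $F$ to $+$: let $e_0$ be an exponent that works for $D$, and put $\epsilon=p^{-e_0}$,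
$\Gamma=\Delta+\epsilon D$. Given $f\colon Y\to X$, choose any $K(X)$-linear $\varphi\colon K(Y)\to
K(X)$ with $\varphi(1)=1$. Its poles on $f_*\mathcal{O}_Y$ are bounded by a divisor $E$
(`exists_divisor_bound`). Global $F$-regularity for $\lceil\Delta\rceil+E$ gives an exponent $e_1$
and a $p^{-e_1}$-linear $\psi$ on $K(X)$ with $\psi(1)=1$ that absorbs these poles
(`NaturalMapSplits.exists_poleLE_map`). Then $s\mapsto\psi(\varphi(s^{p^{e_0+e_1}}))$ sends
$f_*\mathcal{O}_Y(\lfloor f^*\Gamma\rfloor)$ to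
$F^{e_0}_*\mathcal{O}_X(\lceil(p^{e_0}-1)\Delta\rceil+D)$, whose natural map splits. Only $e_1$
depends on $Y$, so one $\epsilon$ serves all covers. -/

/-- The rational function `s` is zero or has a pole of order at most `n` at `x`. -/
def PoleLE [IsIntegral X] [IsLocallyNoetherian X] (x : X) (n : ℤ) (s : X.functionField) : Prop :=
  s = 0 ∨ 0 ≤ X.ord s x + n

theorem genericPoint_mem [IsIntegral X] {U : X.Opens} {x : X} (hx : x ∈ U) : genericPoint X ∈ U :=
  ((genericPoint_spec X).mem_open_set_iff U.isOpen).2 ⟨x, trivial, hx⟩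

theorem apply_genericPoint_specializes [IsIntegral X] [IsIntegral Y] (f : Y ⟶ X) [IsDominant f]
    (x : X) : f (genericPoint Y) ⤳ x := by
  have h := (genericPoint_spec Y).image f.continuous
  rw [Set.image_univ, f.denseRange.closure_range] at h
  exact h.specializes trivial

theorem apply_genericPoint [IsIntegral X] [IsIntegral Y] (f : Y ⟶ X) [IsDominant f] :
    f (genericPoint Y) = genericPoint X :=
  ((apply_genericPoint_specializes f _).antisymm
    ((genericPoint_spec X).specializes trivial)).eq

/-! ### Transfer of splittings along maps of function fields -/

section Transfer

variable [IsIntegral X]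
  [IsIntegral Y] [IsLocallyNoetherian Y] [IsNormalScheme Y]
  [IsIntegral Z] [IsLocallyNoetherian Z] [IsNormalScheme Z]
  (f : Y ⟶ X) (g : Z ⟶ X) [IsDominant f]

/-- The generic point of the source of a dominant morphism, as a point of the preimage of an open
set with a point in the image of another morphism. -/
def genericPointPreimage {U : X.Opens} (z : (g ⁻¹ᵁ U : Z.Opens)) : (f ⁻¹ᵁ U : Y.Opens) :=
  ⟨genericPoint Y, (apply_genericPoint_specializes f _).mem_open U.isOpen z.2⟩

omit [IsNormalScheme Y] [IsNormalScheme Z] in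
theorem isSectionOfDivisor_transfer {E : WeilDivisor Y} {E' : WeilDivisor Z}
    (ψ : Y.functionField →+ Z.functionField)
    (hψE : ∀ (P : PrimeDivisor Z) (s : Y.functionField),
      (∀ Q : PrimeDivisor Y, f Q.1 = g P.1 → PoleLE Q.1 (E Q) s) → PoleLE P.1 (E' P) (ψ s))
    {U : X.Opens} {s : (f ⁻¹ᵁ U : Y.Opens) → Y.functionField} (hs : IsSectionOfDivisor E s) :
    IsSectionOfDivisor E' (U := g ⁻¹ᵁ U) (fun z => ψ (s (genericPointPreimage f g z))) := by
  refine ⟨fun _ _ => rfl, fun P hP => hψE P _ fun Q hQ => ?_⟩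
  have hQU : Q.1 ∈ f ⁻¹ᵁ U := by
    change f Q.1 ∈ U
    rw [hQ]
    exact hP
  rw [hs.1 (genericPointPreimage f g ⟨P.1, hP⟩) ⟨Q.1, hQU⟩]
  exact hs.2 Q hQU

/-- An additive map of function fields that is compatible with the structure sheaf of `X` and
with pole bounds gives a morphism between the pushforwards of divisorial sheaves. -/
def transferHom {E : WeilDivisor Y} {E' : WeilDivisor Z}
    (ψ : Y.functionField →+ Z.functionField)
    (hψ : ∀ (U : X.Opens) (hY : genericPoint Y ∈ f ⁻¹ᵁ U) (hZ : genericPoint Z ∈ g ⁻¹ᵁ U)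
      (r : Γ(X, U)) (s : Y.functionField),
      ψ (Y.presheaf.germ _ _ hY (f.app U r) * s) = Z.presheaf.germ _ _ hZ (g.app U r) * ψ s)
    (hψE : ∀ (P : PrimeDivisor Z) (s : Y.functionField),
      (∀ Q : PrimeDivisor Y, f Q.1 = g P.1 → PoleLE Q.1 (E Q) s) → PoleLE P.1 (E' P) (ψ s)) :
    (Scheme.Modules.pushforward f).obj (sheafOfDivisor E) ⟶
      (Scheme.Modules.pushforward g).obj (sheafOfDivisor E') where
  val :=
    { app := fun U => ModuleCat.ofHom (R := X.ringCatSheaf.obj.obj U)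
        (X := ((Scheme.Modules.pushforward f).obj (sheafOfDivisor E)).val.obj U)
        (Y := ((Scheme.Modules.pushforward g).obj (sheafOfDivisor E')).val.obj U)
        { toFun := fun (s : DivisorSections E (f ⁻¹ᵁ U.unop)) =>
            (⟨_, isSectionOfDivisor_transfer f g ψ hψE s.2⟩ : DivisorSections E' (g ⁻¹ᵁ U.unop))
          map_add' := fun s t => Subtype.ext (funext fun z => map_add ψ _ _)
          map_smul' := fun r s => Subtype.ext (funext fun z => by
            have hZ := genericPoint_mem z.2
            have hY := (genericPointPreimage f g z).2
            have h := hψ U.unop hY hZ r (s.1 (genericPointPreimage f g z))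
            have : Nonempty (f ⁻¹ᵁ U.unop : Y.Opens) := ⟨genericPointPreimage f g z⟩
            have : Nonempty (g ⁻¹ᵁ U.unop : Z.Opens) := ⟨z⟩
            refine Eq.trans (congrArg (fun t => ψ (t * _)) ?_) (h.trans (congrArg (· * _) ?_))
            · exact Scheme.algebraMap_germ_eq_germToFunctionField Y hY (f.app U.unop r)
            · exact (Scheme.algebraMap_germ_eq_germToFunctionField Z z.2 (g.app U.unop r)).symm) }
      naturality := by
        intro U V i
        refine ModuleCat.hom_ext (LinearMap.ext fun s => ?_)
        exact Subtype.ext (funext fun x => rfl) }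

/-- Since `ψ 1 = 1`, the morphism induced by `ψ` is compatible with the two natural maps out of
$\mathcal{O}_X$; composing it with a left inverse of the second gives a left inverse of the first.
-/
theorem NaturalMapSplits.of_transfer {E : WeilDivisor Y} {E' : WeilDivisor Z} (hE : 0 ≤ E)
    (ψ : Y.functionField →+ Z.functionField) (hψ1 : ψ 1 = 1)
    (hψ : ∀ (U : X.Opens) (hY : genericPoint Y ∈ f ⁻¹ᵁ U) (hZ : genericPoint Z ∈ g ⁻¹ᵁ U)
      (r : Γ(X, U)) (s : Y.functionField),
      ψ (Y.presheaf.germ _ _ hY (f.app U r) * s) = Z.presheaf.germ _ _ hZ (g.app U r) * ψ s)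
    (hψE : ∀ (P : PrimeDivisor Z) (s : Y.functionField),
      (∀ Q : PrimeDivisor Y, f Q.1 = g P.1 → PoleLE Q.1 (E Q) s) → PoleLE P.1 (E' P) (ψ s))
    (h : NaturalMapSplits g E') : NaturalMapSplits f E := by
  obtain ⟨hE', ⟨⟨ρ, hρ⟩⟩⟩ := h
  refine ⟨hE, ⟨⟨transferHom f g ψ hψ hψE ≫ ρ, ?_⟩⟩⟩
  rw [← Category.assoc]
  refine Eq.trans (congrArg (· ≫ ρ) ?_) hρ
  refine Scheme.Modules.hom_ext _ _ fun U => ?_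
  refine AddCommGrpCat.hom_ext (AddMonoidHom.ext fun r => ?_)
  refine Subtype.ext (funext fun z => ?_)
  have hZ := genericPoint_mem z.2
  have hY := (genericPointPreimage f g z).2
  have h := hψ U hY hZ r 1
  have : Nonempty (f ⁻¹ᵁ U : Y.Opens) := ⟨genericPointPreimage f g z⟩
  have : Nonempty (g ⁻¹ᵁ U : Z.Opens) := ⟨z⟩
  rw [hψ1, mul_one, mul_one] at h
  change ψ (germsInFunctionField (f ⁻¹ᵁ U) (f.app U r) (genericPointPreimage f g z)) =
    germsInFunctionField (g ⁻¹ᵁ U) (g.app U r) z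
  refine Eq.trans (congrArg ψ ?_) (h.trans ?_)
  · exact Scheme.algebraMap_germ_eq_germToFunctionField Y hY (f.app U r)
  · exact (Scheme.algebraMap_germ_eq_germToFunctionField Z (U := g ⁻¹ᵁ U) z.2 (g.app U r)).symm

end Transfer

/-! ### Retractions of the Frobenius -/

section FrobeniusRetraction

/-- An additive map with values in a field that is inverse-Frobenius-linear over a domain extends
to the fraction field. -/
theorem exists_extend_pow_linear {R K : Type*} [CommRing R] [IsDomain R] [Field K] [Algebra R K]
    [IsFractionRing R K] {q : ℕ} (hq : q ≠ 0) (ρ : R →+ K)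
    (hρ : ∀ r a : R, ρ (r ^ q * a) = algebraMap R K r * ρ a) :
    ∃ ψ : K →+ K, (∀ a, ψ (algebraMap R K a) = ρ a) ∧ ∀ k s : K, ψ (k ^ q * s) = k * ψ s := by
  have hinj := IsFractionRing.injective R K
  -- Denominators can be made $q$-th powers: $a/b=b^{q-1}a/b^q$. Linearity then forces the value
  -- $\rho(b^{q-1}a)/b$.
  have key : ∀ s : K, ∃ b a : R, b ≠ 0 ∧ algebraMap R K b ^ q * s = algebraMap R K a := by
    intro s
    obtain ⟨a, b, hb, rfl⟩ := IsFractionRing.div_surjective (A := R) s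
    have hb0 : b ≠ 0 := nonZeroDivisors.ne_zero hb
    have hb' : algebraMap R K b ≠ 0 := (map_ne_zero_iff _ hinj).2 hb0
    obtain ⟨n, rfl⟩ := Nat.exists_eq_succ_of_ne_zero hq
    refine ⟨b, b ^ n * a, hb0, ?_⟩
    rw [map_mul, map_pow, Nat.succ_eq_add_one, pow_succ]
    field_simp
  choose b a hb hba using key
  have hb' : ∀ s, algebraMap R K (b s) ≠ 0 := fun s => (map_ne_zero_iff _ hinj).2 (hb s)
  let ψ : K → K := fun s => ρ (a s) / algebraMap R K (b s)
  -- Independence of the chosen representation; additivity and linearity follow by picking suitable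
  -- ones.
  have hψ : ∀ (s : K) (c d : R), algebraMap R K c ^ q * s = algebraMap R K d →
      algebraMap R K c * ψ s = ρ d := by
    intro s c d h
    have h1 : (b s) ^ q * d = c ^ q * a s := by
      apply hinj
      rw [map_mul, map_mul, map_pow, map_pow, ← h, ← hba]
      ring
    have h2 := congrArg ρ h1
    rw [hρ, hρ] at h2
    have := hb' s
    simp only [ψ]
    rw [mul_div_assoc', div_eq_iff this, ← h2, mul_comm]
  refine ⟨⟨⟨ψ, ?_⟩, ?_⟩, ?_, ?_⟩
  · have h := hψ 0 1 0 (by simp)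
    simpa using h
  · intro s t
    have h := hψ (s + t) (b s * b t) (b t ^ q * a s + b s ^ q * a t) (by
      simp only [map_mul, map_add, map_pow, ← hba]
      ring)
    rw [map_add, hρ, hρ, ← hψ s _ _ (hba s), ← hψ t _ _ (hba t), map_mul] at h
    have h1 := mul_ne_zero (hb' s) (hb' t)
    refine mul_left_cancel₀ h1 (h.trans ?_)
    simp only
    ring
  · intro r
    have h := hψ (algebraMap R K r) 1 r (by simp)
    simpa using h
  · intro k s
    obtain ⟨c, d, hd, rfl⟩ := IsFractionRing.div_surjective (A := R) k
    have hd' : algebraMap R K d ≠ 0 := (map_ne_zero_iff _ hinj).2 (nonZeroDivisors.ne_zero hd)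
    have h := hψ ((algebraMap R K c / algebraMap R K d) ^ q * s) (d * b s) (c ^ q * a s) (by
      simp only [map_mul, map_pow, ← hba, mul_pow, div_pow]
      field_simp)
    rw [hρ, ← hψ s _ _ (hba s), map_mul] at h
    have h1 := mul_ne_zero hd' (hb' s)
    refine mul_left_cancel₀ h1 (h.trans ?_)
    simp only [AddMonoidHom.coe_mk, ZeroHom.coe_mk]
    field_simp

variable [IsIntegral X] [IsLocallyNoetherian X] [IsNormalScheme X]
  {p : ℕ} [Fact p.Prime] {hX : HasCharP X p}

/-- Restriction of sections of `𝒪_X(D)`. -/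
def DivisorSections.res {D : WeilDivisor X} {U V : X.Opens} (i : V ⟶ U) (s : DivisorSections D U) :
    DivisorSections D V :=
  ⟨fun x => s.1 (i x), (divisorPredicate D).res i s.1 s.2⟩

/-- The left inverse in elementary terms: $\mathcal{O}_X$ acts on $F^e_*$ through $p^e$-th powers,
whence the form of the linearity condition. -/
theorem NaturalMapSplits.exists_retraction {e : ℕ} {A : WeilDivisor X}
    (h : NaturalMapSplits (absoluteFrobenius p hX e) A) :
    ∃ ρ : ∀ U : X.Opens, DivisorSections A U →+ Γ(X, U),
      (∀ U (r : Γ(X, U)) s, ρ U (r ^ p ^ e • s) = r * ρ U s) ∧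
      (∀ (U V : X.Opens) (i : V ⟶ U) s, ρ V (s.res i) = X.presheaf.map i.op (ρ U s)) ∧
      ∀ (U : X.Opens) (s : DivisorSections A U), s.1 = 1 → ρ U s = 1 := by
  obtain ⟨hA, ⟨⟨ρ, hρ⟩⟩⟩ := h
  refine ⟨fun U => (ρ.app U).hom, fun U r s => ?_, fun U V i s => ?_, fun U s hs => ?_⟩
  · exact ρ.app_smul (U := U) r s
  · exact ConcreteCategory.congr_hom (ρ.mapPresheaf.naturality i.op) s
  · have h1 := ConcreteCategory.congr_hom (congrArg (fun φ => Scheme.Modules.Hom.app φ U) hρ)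
      (1 : Γ(X, U))
    refine Eq.trans (congrArg (ρ.app U).hom (Subtype.ext ?_)) h1
    refine hs.trans ?_
    refine (map_one (germsInFunctionField U)).symm.trans ?_
    exact congrArg (germsInFunctionField U) (map_one ((absoluteFrobenius p hX e).app U).hom).symm

/-- A section of `𝒪_X(D)` over `U` from a rational function. -/
def DivisorSections.ofFunction {D : WeilDivisor X} {U : X.Opens} (s : X.functionField)
    (hs : ∀ P : PrimeDivisor X, P.1 ∈ U → PoleLE P.1 (D P) s) : DivisorSections D U :=
  ⟨fun _ => s, fun _ _ => rfl, fun P hP => hs P hP⟩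

/-- A splitting of `𝒪_X ⟶ F^e_*𝒪_X(A)` gives an inverse-Frobenius-linear map on the function
field, sending sections of `𝒪_X(A)` to functions. -/
theorem NaturalMapSplits.exists_function {e : ℕ} {A : WeilDivisor X}
    (h : NaturalMapSplits (absoluteFrobenius p hX e) A) :
    ∃ ψ : X.functionField →+ X.functionField, ψ 1 = 1 ∧
      (∀ k s, ψ (k ^ p ^ e * s) = k * ψ s) ∧
      ∀ (U : X.Opens) [Nonempty U] (s : X.functionField),
        (∀ P : PrimeDivisor X, P.1 ∈ U → PoleLE P.1 (A P) s) →
        ∃ r : Γ(X, U), ψ s = X.germToFunctionField U r := by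
  obtain ⟨hA, -⟩ := id h
  obtain ⟨ρ, hsmul, hres, hone⟩ := h.exists_retraction
  obtain ⟨_, ⟨W, hW, rfl⟩, hxW, -⟩ := X.isBasis_affineOpens.exists_subset_of_mem_open
    (Set.mem_univ (genericPoint X)) isOpen_univ
  have hWn : Nonempty W := ⟨⟨_, hxW⟩⟩
  have := functionField_isFractionRing_of_isAffineOpen X W hW
  have hq : p ^ e ≠ 0 := pow_ne_zero e (Fact.out : p.Prime).ne_zero
  have hgerm : ∀ (U : X.Opens) [Nonempty U] (r : Γ(X, U)) (x : U),
      germsInFunctionField U r x = X.germToFunctionField U r := fun U _ r x =>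
    Scheme.algebraMap_germ_eq_germToFunctionField X x.2 r
  let γ : ∀ U : X.Opens, Γ(X, U) →+ DivisorSections A U := fun U =>
    { toFun := fun r => ⟨germsInFunctionField U r, isSectionOfDivisor_germs hA U r⟩
      map_zero' := Subtype.ext (map_zero _)
      map_add' := fun r r' => Subtype.ext (map_add _ r r') }
  have hγ : ∀ U (r a : Γ(X, U)), γ U (r * a) = r • γ U a := fun U r a =>
    Subtype.ext (map_mul _ r a)
  obtain ⟨ψ, hψ, hψq⟩ := exists_extend_pow_linear (K := X.functionField) hq
    ((X.germToFunctionField W).hom.toAddMonoidHom.comp ((ρ W).comp (γ W)))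
    (fun r a => by
      change X.germToFunctionField W (ρ W (γ W (r ^ p ^ e * a))) = _
      rw [hγ, hsmul, map_mul]
      rfl)
  replace hψ : ∀ a : Γ(X, W), ψ (X.germToFunctionField W a) =
    X.germToFunctionField W (ρ W (γ W a)) := hψ
  refine ⟨ψ, ?_, hψq, fun U hU s hs => ?_⟩
  · have h1 := hψ 1
    have h2 := map_one (X.germToFunctionField W).hom
    rw [hone W _ (map_one (germsInFunctionField W))] at h1
    exact (congrArg ψ h2).symm.trans (h1.trans h2)
  · let σ : DivisorSections A U := .ofFunction s hs
    refine ⟨ρ U σ, ?_⟩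
    -- `ψ` was built from `ρ W`. Both `s` and the fractions from `W` restrict to `V`, where
    -- compatibility of `ρ` with restriction identifies `ψ s` with the germ of `ρ U σ`.
    let V := U ⊓ W
    have hxU : genericPoint X ∈ U := genericPoint_mem hU.some.2
    have hVn : Nonempty V := ⟨⟨genericPoint X, hxU, hxW⟩⟩
    let i : V ⟶ U := homOfLE inf_le_left
    let j : V ⟶ W := homOfLE inf_le_right
    have hi : ∀ r, X.germToFunctionField V (X.presheaf.map i.op r) = X.germToFunctionField U r :=
      fun r => X.presheaf.germ_res_apply i _ _ r
    have hj : ∀ r, X.germToFunctionField V (X.presheaf.map j.op r) = X.germToFunctionField W r :=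
      fun r => X.presheaf.germ_res_apply j _ _ r
    obtain ⟨a, b, hb, hab⟩ : ∃ a b : Γ(X, W), b ≠ 0 ∧
        X.germToFunctionField W b ^ p ^ e * s = X.germToFunctionField W a := by
      obtain ⟨c, b, hb, hcb⟩ := IsFractionRing.div_surjective (A := Γ(X, W)) s
      have hb0 : b ≠ 0 := nonZeroDivisors.ne_zero hb
      have hb' : X.germToFunctionField W b ≠ 0 :=
        (map_ne_zero_iff _ (X.germToFunctionField_injective W)).2 hb0
      obtain ⟨n, hn⟩ := Nat.exists_eq_succ_of_ne_zero hq
      refine ⟨b ^ n * c, b, hb0, ?_⟩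
      rw [map_mul, map_pow, hn, pow_succ, ← hcb]
      change _ * (X.germToFunctionField W c / X.germToFunctionField W b) = _
      field_simp
    have hb' : X.germToFunctionField W b ≠ 0 :=
      (map_ne_zero_iff _ (X.germToFunctionField_injective W)).2 hb
    have h1 : (X.presheaf.map j.op b) ^ p ^ e • σ.res i = (γ W a).res j := by
      refine Subtype.ext (funext fun x => ?_)
      change germsInFunctionField V ((X.presheaf.map j.op b) ^ p ^ e) x * s =
        germsInFunctionField W a (j x)
      rw [hgerm, hgerm, map_pow, hj, hab]
    have h2 := congrArg (fun t => X.germToFunctionField V (ρ V t)) h1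
    simp only [hsmul, hres, map_mul, hi, hj] at h2
    rw [← hψ, ← hab, hψq] at h2
    exact (mul_left_cancel₀ hb' h2).symm

end FrobeniusRetraction

/-! ### Points of codimension one -/

theorem PrimeDivisor.ne_genericPoint [IsIntegral X] (P : PrimeDivisor X) :
    P.1 ≠ genericPoint X := by
  intro h
  have h0 : Order.coheight P.1 = 0 := Order.coheight_eq_zero.2 fun y _ =>
    h ▸ (Scheme.le_iff_specializes.2 ((genericPoint_spec X).specializes trivial))
  rw [P.2] at h0
  exact one_ne_zero h0

theorem PrimeDivisor.eq_of_specializes [IsIntegral X] (P : PrimeDivisor X) {t : X}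
    (ht : t ≠ genericPoint X) (h : t ⤳ P.1) : t = P.1 := by
  by_contra hne
  have hlt : P.1 < t := lt_of_le_not_ge (Scheme.le_iff_specializes.2 h)
    fun h' => hne (h.antisymm (Scheme.le_iff_specializes.1 h')).eq
  have h1 := Order.coheight_add_one_le hlt
  rw [P.2] at h1
  have h0 : Order.coheight t = 0 := by
    have : Order.coheight t + 1 ≤ 0 + 1 := by rwa [zero_add]
    exact le_antisymm (ENat.add_le_add_iff_right (by simp) |>.1 this) bot_le
  have hmax := Order.coheight_eq_zero.1 h0
  have h2 : genericPoint X ⤳ t := (genericPoint_spec X).specializes trivial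
  exact ht ((Scheme.le_iff_specializes.1 (hmax (Scheme.le_iff_specializes.2 h2))).antisymm h2).eq

/-- Only finitely many prime divisors of a Noetherian integral scheme miss a given nonempty open
set. -/
theorem finite_primeDivisor_notMem [IsIntegral X] [IsNoetherian X] (U : X.Opens) [Nonempty U] :
    {P : PrimeDivisor X | P.1 ∉ U}.Finite := by
  obtain ⟨S, hS, hSc, hSi, hSU⟩ := NoetherianSpace.exists_finite_set_isClosed_irreducible
    (isClosed_compl_iff.2 U.isOpen)
  have key : ∀ P : PrimeDivisor X, P.1 ∉ U → ∃ T ∈ S, IsGenericPoint P.1 T := by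
    intro P hP
    have hP' : P.1 ∈ ⋃₀ S := hSU ▸ hP
    obtain ⟨T, hT, hPT⟩ := hP'
    refine ⟨T, hT, ?_⟩
    have ht := (hSi T hT).isGenericPoint_genericPoint (hSc T hT)
    set t := (hSi T hT).genericPoint
    have htU : t ∈ (U : Set X)ᶜ := hSU ▸ ⟨T, hT, ht.mem⟩
    -- The generic point `t` of a component of the complement is not generic in `X` but specializes
    -- to `P`, so codimension one forces `t = P`.
    have h1 : t ≠ genericPoint X := by
      intro h
      obtain ⟨x, hx⟩ := ‹Nonempty U›
      exact htU (h ▸ genericPoint_mem hx)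
    rwa [← P.eq_of_specializes h1 (ht.specializes hPT)]
  choose! T hT using key
  refine Set.Finite.of_finite_image (f := T) (hS.subset ?_) ?_
  · rintro _ ⟨P, hP, rfl⟩
    exact (hT P hP).1
  · intro P hP Q hQ h
    have h1 := (hT P hP).2
    rw [h] at h1
    exact Subtype.ext (h1.eq (hT Q hQ).2)

/-! ### Pole orders -/

section Poles

variable [IsIntegral X] [IsLocallyNoetherian X]

theorem PoleLE.mono {x : X} {m n : ℤ} {s : X.functionField} (h : PoleLE x m s) (hmn : m ≤ n) :
    PoleLE x n s :=
  h.imp_right fun h => by omega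

theorem PoleLE.mul {x : X} {m n : ℤ} {s t : X.functionField} (hs : PoleLE x m s)
    (ht : PoleLE x n t) : PoleLE x (m + n) (s * t) := by
  by_cases hs0 : s = 0
  · exact Or.inl (by rw [hs0, zero_mul])
  by_cases ht0 : t = 0
  · exact Or.inl (by rw [ht0, mul_zero])
  have h1 := hs.resolve_left hs0
  have h2 := ht.resolve_left ht0
  refine Or.inr ?_
  rw [Scheme.ord_mul hs0 ht0]
  omega

theorem poleLE_germ {U : X.Opens} [Nonempty U] {x : X} (hx : x ∈ U) (r : Γ(X, U)) :
    PoleLE x 0 (X.germToFunctionField U r) := by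
  by_cases hr : r = 0
  · exact Or.inl (by rw [hr, map_zero])
  · right
    have h1 := Scheme.ord_le_smul hx hr (1 : X.functionField)
    have h2 := Scheme.ord_of_isUnit (X := X) (f := (1 : Γ(X, U))) isUnit_one hx
    rw [map_one] at h2
    rw [h2, Algebra.smul_def, mul_one] at h1
    rw [add_zero]
    exact h1

theorem PoleLE.one (x : X) : PoleLE x 0 (1 : X.functionField) := by
  have : Nonempty (⊤ : X.Opens) := ⟨⟨x, trivial⟩⟩
  have h := poleLE_germ (U := ⊤) (x := x) trivial 1
  rwa [map_one] at h

theorem PoleLE.pow {x : X} {n : ℤ} {s : X.functionField} (hs : PoleLE x n s) (k : ℕ) :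
    PoleLE x (k * n) (s ^ k) := by
  induction k with
  | zero => simpa using PoleLE.one x
  | succ k ih =>
    rw [pow_succ]
    refine (ih.mul hs).mono (le_of_eq ?_)
    push_cast
    ring

variable [IsNormalScheme X] (P : PrimeDivisor X)

theorem PrimeDivisor.ord_algebraMap {a : X.presheaf.stalk P.1} (ha : a ≠ 0) {n : ℕ}
    (hn : Ring.ord (X.presheaf.stalk P.1) a = n) :
    X.ord (algebraMap (X.presheaf.stalk P.1) X.functionField a) P.1 = n := by
  have := isDiscreteValuationRing_stalk P.2
  have hK : algebraMap (X.presheaf.stalk P.1) X.functionField a ≠ 0 :=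
    (map_ne_zero_iff _ (IsFractionRing.injective _ _)).2 ha
  rw [Scheme.ord_eq_iff P.2 hK]
  have : Ring.KrullDimLE 1 (X.presheaf.stalk P.1) := krullDimLE_of_coheight_le P.2.le
  refine (Ring.ordFrac_eq_ord (X.presheaf.stalk P.1) ha).trans ?_
  exact Ring.ordMonoidWithZeroHom_eq_coe _ (mem_nonZeroDivisors_of_ne_zero ha) hn

omit [IsNormalScheme X] in
theorem PrimeDivisor.poleLE_algebraMap (a : X.presheaf.stalk P.1) :
    PoleLE P.1 0 (algebraMap (X.presheaf.stalk P.1) X.functionField a) := by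
  obtain ⟨U, hU, r, rfl⟩ := X.presheaf.exists_germ_eq a
  have : Nonempty U := ⟨⟨_, hU⟩⟩
  rw [Scheme.algebraMap_germ_eq_germToFunctionField]
  exact poleLE_germ hU r

omit [IsNormalScheme X] in
theorem PrimeDivisor.ord_zpow {s : X.functionField} (hs : s ≠ 0) (n : ℤ) :
    X.ord (s ^ n) P.1 = n * X.ord s P.1 := by
  have h1 := (Scheme.ord_eq_iff P.2 hs).1 rfl
  rw [Scheme.ord_eq_iff P.2 (zpow_ne_zero n hs), map_zpow₀, h1, ← WithZero.coe_zpow, ← ofAdd_zsmul,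
    smul_eq_mul]

omit [IsNormalScheme X] in
theorem PrimeDivisor.poleLE_zpow_mul_iff {s t : X.functionField} (hs : s ≠ 0) (m n : ℤ) :
    PoleLE P.1 m (s ^ n * t) ↔ PoleLE P.1 (m + n * X.ord s P.1) t := by
  by_cases ht : t = 0
  · simp [PoleLE, ht]
  · have h0 := zpow_ne_zero n hs
    simp only [PoleLE, mul_eq_zero, h0, ht, false_or, Scheme.ord_mul h0 ht, P.ord_zpow hs]
    constructor <;> intro h <;> omega

theorem PrimeDivisor.ord_algebraMap_irreducible {ϖ : X.presheaf.stalk P.1} (hϖ : Irreducible ϖ) :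
    X.ord (algebraMap (X.presheaf.stalk P.1) X.functionField ϖ) P.1 = 1 := by
  have := isDiscreteValuationRing_stalk P.2
  exact P.ord_algebraMap hϖ.ne_zero (n := 1) (by simpa using Ring.ord_of_irreducible hϖ)

theorem PrimeDivisor.ord_algebraMap_isUnit {v : X.presheaf.stalk P.1} (hv : IsUnit v) :
    X.ord (algebraMap (X.presheaf.stalk P.1) X.functionField v) P.1 = 0 :=
  P.ord_algebraMap hv.ne_zero (n := 0) (Ring.ord_of_isUnit hv)

/-- In a discrete valuation ring a nonzero fraction is a unit times a power of a uniformizer, and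
the order reads off the exponent. -/
theorem PrimeDivisor.poleLE_zero_iff {s : X.functionField} :
    PoleLE P.1 0 s ↔ ∃ a, algebraMap (X.presheaf.stalk P.1) X.functionField a = s := by
  have hd := isDiscreteValuationRing_stalk P.2
  refine ⟨?_, ?_⟩
  · rintro (rfl | h)
    · exact ⟨0, map_zero _⟩
    obtain ⟨ϖ, hϖ⟩ := IsDiscreteValuationRing.exists_irreducible (X.presheaf.stalk P.1)
    have hinj := IsFractionRing.injective (X.presheaf.stalk P.1) X.functionField
    obtain ⟨a, b, hb, rfl⟩ := IsFractionRing.div_surjective (A := X.presheaf.stalk P.1) s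
    have hb0 := nonZeroDivisors.ne_zero hb
    by_cases ha0 : a = 0
    · exact ⟨0, by rw [ha0, map_zero, zero_div]⟩
    obtain ⟨m, v, rfl⟩ := IsDiscreteValuationRing.eq_unit_mul_pow_irreducible hb0 hϖ
    obtain ⟨k, w, rfl⟩ := IsDiscreteValuationRing.eq_unit_mul_pow_irreducible ha0 hϖ
    have hK : algebraMap (X.presheaf.stalk P.1) X.functionField ϖ ≠ 0 :=
      (map_ne_zero_iff _ hinj).2 hϖ.ne_zero
    have hv : ∀ v : (X.presheaf.stalk P.1)ˣ,
        algebraMap (X.presheaf.stalk P.1) X.functionField v ≠ 0 := fun v =>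
      (map_ne_zero_iff _ hinj).2 v.ne_zero
    have hvw : algebraMap (X.presheaf.stalk P.1) X.functionField v *
        algebraMap (X.presheaf.stalk P.1) X.functionField ↑v⁻¹ = 1 := by
      rw [← map_mul, Units.mul_inv, map_one]
    have heq : algebraMap (X.presheaf.stalk P.1) X.functionField (w * ϖ ^ k) /
        algebraMap _ _ (v * ϖ ^ m) = algebraMap (X.presheaf.stalk P.1) X.functionField ↑(w * v⁻¹) *
          algebraMap (X.presheaf.stalk P.1) X.functionField ϖ ^ ((k : ℤ) - m) := by
      rw [zpow_sub₀ hK, zpow_natCast, zpow_natCast, map_mul, map_mul, map_pow, map_pow,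
        Units.val_mul, map_mul, eq_inv_of_mul_eq_one_right hvw]
      have := hv v
      field_simp
    rw [heq, Scheme.ord_mul (hv _) (zpow_ne_zero _ hK), P.ord_algebraMap_isUnit (Units.isUnit _),
      P.ord_zpow hK, P.ord_algebraMap_irreducible hϖ] at h
    obtain ⟨j, rfl⟩ := Nat.exists_eq_add_of_le (show m ≤ k by omega)
    refine ⟨↑(w * v⁻¹) * ϖ ^ j, ?_⟩
    rw [heq, map_mul, map_pow, show ((m + j : ℕ) : ℤ) - m = j by push_cast; ring, zpow_natCast]
  · rintro ⟨a, rfl⟩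
    exact P.poleLE_algebraMap a

end Poles

/-- If a rational function has its pole at `P` bounded by an effective divisor, this holds on an
open neighbourhood of `P`. -/
theorem exists_open_poleLE [IsIntegral X] [IsNoetherian X] {A : WeilDivisor X} (hA : 0 ≤ A)
    (P : PrimeDivisor X) {s : X.functionField} (hs : PoleLE P.1 (A P) s) :
    ∃ U : X.Opens, P.1 ∈ U ∧ ∀ Q : PrimeDivisor X, Q.1 ∈ U → PoleLE Q.1 (A Q) s := by
  by_cases hs0 : s = 0
  · exact ⟨⊤, trivial, fun Q _ => Or.inl hs0⟩
  obtain ⟨U, -, t, hU, rfl, ht⟩ := exists_isUnit_germ_eq X s hs0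
  -- On `U` the function is regular, so `A ≥ 0` suffices there. Only finitely many prime divisors
  -- miss `U`; the closures of those other than `P` avoid the point `P` and can be removed.
  let B : Set (PrimeDivisor X) := {Q | Q.1 ∉ U ∧ Q ≠ P}
  have hB : B.Finite := (finite_primeDivisor_notMem U).subset fun Q hQ => hQ.1
  let C : Set X := ⋃ Q ∈ B, closure {Q.1}
  have hC : IsClosed C := hB.isClosed_biUnion fun _ _ => isClosed_closure
  refine ⟨⟨Cᶜ, hC.isOpen_compl⟩, ?_, ?_⟩
  · intro h
    obtain ⟨Q, hQ, hPQ⟩ := Set.mem_iUnion₂.1 h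
    exact hQ.2 (Subtype.ext (P.eq_of_specializes Q.ne_genericPoint
      (specializes_iff_mem_closure.2 hPQ)))
  · intro Q hQ
    by_cases hQP : Q = P
    · rwa [hQP]
    by_cases hQU : Q.1 ∈ U
    · exact (poleLE_germ hQU t).mono (hA Q)
    · exact absurd (Set.mem_biUnion (show Q ∈ B from ⟨hQU, hQP⟩) (subset_closure (Set.mem_singleton Q.1))) hQ

/-! ### Finite dominant morphisms -/

section FunctionFieldMap

variable [IsIntegral X] [IsIntegral Y] (f : Y ⟶ X) [IsDominant f]

/-- The extension of function fields of a dominant morphism. -/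
def functionFieldMap : X.functionField →+* Y.functionField :=
  (X.presheaf.stalkSpecializes (apply_genericPoint_specializes f (genericPoint X)) ≫
    f.stalkMap (genericPoint Y)).hom

theorem functionFieldMap_germ {U : X.Opens} [Nonempty U] [Nonempty (f ⁻¹ᵁ U : Y.Opens)]
    (r : Γ(X, U)) :
    functionFieldMap f (X.germToFunctionField U r) =
      Y.germToFunctionField (f ⁻¹ᵁ U) (f.app U r) := by
  have h : genericPoint X ∈ U := genericPoint_mem (‹Nonempty U›.some.2)
  change f.stalkMap (genericPoint Y) (X.presheaf.stalkSpecializes _ (X.presheaf.germ U _ h r)) = _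
  rw [TopCat.Presheaf.germ_stalkSpecializes_apply, Scheme.Hom.germ_stalkMap_apply]

theorem functionFieldMap_algebraMap (y : Y) (a : X.presheaf.stalk (f y)) :
    functionFieldMap f (algebraMap (X.presheaf.stalk (f y)) X.functionField a) =
      algebraMap (Y.presheaf.stalk y) Y.functionField (f.stalkMap y a) := by
  obtain ⟨U, hU, r, rfl⟩ := X.presheaf.exists_germ_eq a
  have : Nonempty U := ⟨⟨_, hU⟩⟩
  have : Nonempty (f ⁻¹ᵁ U : Y.Opens) := ⟨⟨y, hU⟩⟩
  rw [Scheme.algebraMap_germ_eq_germToFunctionField, functionFieldMap_germ,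
    Scheme.Hom.germ_stalkMap_apply]
  exact (Scheme.algebraMap_germ_eq_germToFunctionField Y (U := f ⁻¹ᵁ U) hU _).symm

end FunctionFieldMap

/-! ### Points and functions over a point of the base -/

section CoheightFinite

variable [IsIntegral X] [IsIntegral Y] (f : Y ⟶ X) [IsFinite f] [IsDominant f]

-- Fibres of a finite morphism are discrete, so there are no proper specializations inside a fibre.
omit [IsIntegral X] [IsIntegral Y] in
theorem strictMono_of_isFinite (f : Y ⟶ X) [IsFinite f] : StrictMono f := by
  intro y z h
  have h1 : z ⤳ y := Scheme.le_iff_specializes.1 h.le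
  refine lt_of_le_not_ge (Scheme.le_iff_specializes.2 (h1.map f.continuous)) fun h' => ?_
  have h2 : f z = f y :=
    ((h1.map f.continuous).antisymm (Scheme.le_iff_specializes.1 h')).eq
  have hd := (f.isDiscrete_preimage_singleton (f y)).to_subtype
  have h3 : (⟨z, h2⟩ : f ⁻¹' {f y}) ⤳ ⟨y, rfl⟩ := Topology.IsInducing.subtypeVal.specializes_iff.1 h1
  have h4 : z = y := congrArg Subtype.val h3.eq
  exact absurd h (h4 ▸ lt_irrefl _)

theorem coheight_eq_one_of_isFinite {y : Y} (P : PrimeDivisor X) (h : f y = P.1) :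
    Order.coheight y = 1 := by
  refine le_antisymm ?_ ?_
  · rw [← P.2, ← h]
    exact Order.coheight_le_coheight_apply_of_strictMono _ (strictMono_of_isFinite f) y
  · rw [Order.one_le_iff_ne_zero, Order.coheight_ne_zero]
    intro hmax
    have h2 : genericPoint Y ⤳ y := (genericPoint_spec Y).specializes trivial
    have h3 : y = genericPoint Y :=
      ((Scheme.le_iff_specializes.1 (hmax (Scheme.le_iff_specializes.2 h2))).antisymm h2).eq
    rw [h3, apply_genericPoint] at h
    exact P.ne_genericPoint h.symm

-- A function regular at all points over `x` has a denominator from the base that is a unit at `x`.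
-- Otherwise its ideal of denominators contracts into the prime of `x`, and lying over yields a
-- point above `x` at which every denominator vanishes.
omit [IsIntegral X] [IsDominant f] in
theorem exists_mul_eq_germ_of_forall_stalk {V : X.Opens} (hV : IsAffineOpen V) {x : X} (hx : x ∈ V)
    [Nonempty V] [Nonempty (f ⁻¹ᵁ V : Y.Opens)] (s : Y.functionField)
    (hs : ∀ y, f y = x → ∃ a, algebraMap (Y.presheaf.stalk y) Y.functionField a = s) :
    ∃ (t : Γ(X, V)) (a : Γ(Y, f ⁻¹ᵁ V)), IsUnit (X.presheaf.germ V x hx t) ∧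
      Y.germToFunctionField (f ⁻¹ᵁ V) (f.app V t) * s = Y.germToFunctionField (f ⁻¹ᵁ V) a := by
  have hW : IsAffineOpen (f ⁻¹ᵁ V) := hV.preimage f
  let I : Ideal Γ(Y, f ⁻¹ᵁ V) :=
    { carrier := {v : Γ(Y, f ⁻¹ᵁ V) | ∃ a, Y.germToFunctionField (f ⁻¹ᵁ V) v * s =
        Y.germToFunctionField (f ⁻¹ᵁ V) a}
      zero_mem' := ⟨0, by simp⟩
      add_mem' := by
        rintro v w ⟨a, ha⟩ ⟨b, hb⟩
        exact ⟨a + b, by rw [map_add, map_add, add_mul, ha, hb]⟩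
      smul_mem' := by
        rintro c v ⟨a, ha⟩
        exact ⟨c * a, by rw [smul_eq_mul, map_mul, map_mul, mul_assoc, ha]⟩ }
  let 𝔭 := hV.primeIdealOf ⟨x, hx⟩
  by_contra! hcon
  have hIP : I.comap (f.app V).hom ≤ 𝔭.asIdeal := by
    intro t ht
    by_contra htp
    obtain ⟨a, ha⟩ := ht
    let := TopCat.Presheaf.algebra_section_stalk X.presheaf ⟨x, hx⟩
    have hloc : IsLocalization.AtPrime (X.presheaf.stalk x) 𝔭.asIdeal :=
      hV.isLocalization_stalk ⟨x, hx⟩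
    exact hcon t a (IsLocalization.map_units (M := 𝔭.asIdeal.primeCompl) (X.presheaf.stalk x)
      ⟨t, htp⟩) ha
  algebraize [(f.app V).hom]
  have hint : (f.app V).hom.Finite := f.finite_app V hV
  have : Module.Finite Γ(X, V) Γ(Y, f ⁻¹ᵁ V) := hint
  obtain ⟨Q, hIQ, hQ, hQP⟩ := Ideal.exists_ideal_over_prime_of_isIntegral 𝔭.asIdeal I hIP
  let 𝔮 : Spec Γ(Y, f ⁻¹ᵁ V) := ⟨Q, hQ⟩
  let y : Y := hW.fromSpec 𝔮
  have hyW : y ∈ f ⁻¹ᵁ V := by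
    have h : y ∈ Set.range hW.fromSpec := ⟨_, rfl⟩
    rwa [hW.range_fromSpec] at h
  have hyQ : hW.primeIdealOf ⟨y, hyW⟩ = 𝔮 :=
    hW.fromSpec.isOpenEmbedding.injective (hW.fromSpec_primeIdealOf ⟨y, hyW⟩)
  have hfy : f y = x := by
    have h1 := IsAffineOpen.comap_primeIdealOf_appLE (f := f) V hV (f ⁻¹ᵁ V) hW le_rfl hyW
    rw [hyQ, Scheme.Hom.appLE_eq_app] at h1
    have h2 : PrimeSpectrum.comap (f.app V).hom 𝔮 = 𝔭 := PrimeSpectrum.ext hQP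
    have h3 := congrArg hV.fromSpec (h1.symm.trans h2)
    exact ((hV.fromSpec_primeIdealOf _).symm.trans h3).trans (hV.fromSpec_primeIdealOf _)
  obtain ⟨b, hb⟩ := hs y hfy
  let := TopCat.Presheaf.algebra_section_stalk Y.presheaf ⟨y, hyW⟩
  have hloc : IsLocalization.AtPrime (Y.presheaf.stalk y) Q :=
    hW.isLocalization_stalk' 𝔮 hyW
  obtain ⟨⟨a, v⟩, hav⟩ := IsLocalization.surj Q.primeCompl b
  -- Regularity at `y` gives a denominator `v` outside `Q`, although `Q` contains the whole ideal of
  -- denominators.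
  refine v.2 (hIQ ⟨a, ?_⟩)
  have h1 := congrArg (algebraMap (Y.presheaf.stalk y) Y.functionField) hav
  rw [map_mul, hb, mul_comm] at h1
  have h2 : ∀ c : Γ(Y, f ⁻¹ᵁ V), algebraMap (Y.presheaf.stalk y) Y.functionField
      (algebraMap Γ(Y, f ⁻¹ᵁ V) (Y.presheaf.stalk y) c) = Y.germToFunctionField (f ⁻¹ᵁ V) c :=
    fun c => Scheme.algebraMap_germ_eq_germToFunctionField Y hyW c
  rwa [h2, h2] at h1

end CoheightFinite

/-! ### Pole bounds for traces -/

section FiniteBounds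

variable [IsIntegral X] [IsIntegral Y] (f : Y ⟶ X)

theorem ord_functionFieldMap_irreducible [IsDominant f] [IsLocallyNoetherian X] [IsNormalScheme X]
    [IsLocallyNoetherian Y] [IsNormalScheme Y] (Q : PrimeDivisor Y)
    (hQ : Order.coheight (f Q.1) = 1) {ϖ : X.presheaf.stalk (f Q.1)} (hϖ : Irreducible ϖ) :
    Y.ord (functionFieldMap f (algebraMap (X.presheaf.stalk (f Q.1)) X.functionField ϖ)) Q.1 =
      ramificationIndex f Q.1 := by
  have hX := isDiscreteValuationRing_stalk hQ
  have hY := isDiscreteValuationRing_stalk Q.2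
  have h0 : functionFieldMap f (algebraMap (X.presheaf.stalk (f Q.1)) X.functionField ϖ) ≠ 0 :=
    (map_ne_zero_iff _ (functionFieldMap f).injective).2
      ((map_ne_zero_iff _ (IsFractionRing.injective _ _)).2 hϖ.ne_zero)
  rw [functionFieldMap_algebraMap] at h0 ⊢
  have h1 : f.stalkMap Q.1 ϖ ≠ 0 := fun h => h0 (by rw [h, map_zero])
  refine Q.ord_algebraMap h1 ?_
  -- The length is finite, so `toNat` in `ramificationIndex` loses nothing.
  have h2 := Ring.ord_ne_top (R := Y.presheaf.stalk Q.1) (mem_nonZeroDivisors_of_ne_zero h1)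
  rw [ramificationIndex, hϖ.maximalIdeal_eq, Ideal.map_span, Set.image_singleton]
  exact (ENat.natCast_toNat h2).symm

variable [IsFinite f] [IsDominant f]

/-- Any linear splitting of the field extension will do; the trace would not, as it can kill $1$ in
characteristic $p$. -/
theorem exists_linear_retraction_functionFieldMap (f : Y ⟶ X) [IsDominant f] :
    ∃ φ : Y.functionField →+ X.functionField, φ 1 = 1 ∧
      ∀ k s, φ (functionFieldMap f k * s) = k * φ s := by
  let := (functionFieldMap f).toAlgebra
  obtain ⟨φ, hφ⟩ := LinearMap.exists_leftInverse_of_injective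
    (Algebra.linearMap X.functionField Y.functionField)
    (LinearMap.ker_eq_bot.2 (functionFieldMap f).injective)
  refine ⟨φ.toAddMonoidHom, ?_, fun k s => φ.map_smul k s⟩
  have h := LinearMap.congr_fun hφ 1
  rwa [LinearMap.comp_apply, Algebra.linearMap_apply, map_one] at h

variable (φ : Y.functionField →+ X.functionField)
  (hφ : ∀ k s, φ (functionFieldMap f k * s) = k * φ s)

-- The sections over the preimage of an affine open form a finite module, so it is enough to clear
-- the denominators of `φ` on generators.
include hφ in
theorem exists_common_denominator {V : X.Opens} (hV : IsAffineOpen V) [Nonempty V]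
    [Nonempty (f ⁻¹ᵁ V : Y.Opens)] :
    ∃ b : Γ(X, V), b ≠ 0 ∧ ∀ a : Γ(Y, f ⁻¹ᵁ V), ∃ r : Γ(X, V),
      X.germToFunctionField V b * φ (Y.germToFunctionField (f ⁻¹ᵁ V) a) =
        X.germToFunctionField V r := by
  have := functionField_isFractionRing_of_isAffineOpen X V hV
  have hfin : (f.app V).hom.Finite := f.finite_app V hV
  algebraize [(f.app V).hom]
  obtain ⟨T, hT⟩ := Module.Finite.fg_top (R := Γ(X, V)) (M := Γ(Y, f ⁻¹ᵁ V))
  obtain ⟨b, hb⟩ := IsLocalization.exist_integer_multiples (nonZeroDivisors Γ(X, V)) T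
    (fun a => φ (Y.germToFunctionField (f ⁻¹ᵁ V) a))
  refine ⟨b, nonZeroDivisors.ne_zero b.2, fun a => ?_⟩
  have ha : a ∈ Submodule.span Γ(X, V) (T : Set Γ(Y, f ⁻¹ᵁ V)) := hT ▸ Submodule.mem_top
  induction ha using Submodule.span_induction with
  | mem a ha =>
    obtain ⟨r, hr⟩ := hb a ha
    refine ⟨r, ?_⟩
    rw [Algebra.smul_def] at hr
    exact hr.symm
  | zero => exact ⟨0, by simp⟩
  | add a a' _ _ h h' =>
    obtain ⟨r, hr⟩ := h
    obtain ⟨r', hr'⟩ := h'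
    exact ⟨r + r', by rw [map_add, map_add, map_add, mul_add, hr, hr']⟩
  | smul c a _ h =>
    obtain ⟨r, hr⟩ := h
    refine ⟨c * r, ?_⟩
    have h1 : c • a = f.app V c * a := rfl
    have h2 : Y.germToFunctionField (f ⁻¹ᵁ V) (f.app V c * a) =
        functionFieldMap f (X.germToFunctionField V c) * Y.germToFunctionField (f ⁻¹ᵁ V) a := by
      rw [map_mul, functionFieldMap_germ]
    rw [h1, h2, hφ, map_mul, ← hr]
    ring

variable [IsLocallyNoetherian Y] [IsNormalScheme Y]

-- Over one affine open, `φ` has a common denominator `b`, hence creates no poles where `b` is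
-- invertible. Finitely many prime divisors remain, and each is bounded by a denominator from an
-- affine neighbourhood.
include hφ in
theorem exists_divisor_bound [IsNoetherian X] [IsNormalScheme X] :
    ∃ E : WeilDivisor X, 0 ≤ E ∧ ∀ (P : PrimeDivisor X) (s : Y.functionField),
      (∀ Q : PrimeDivisor Y, f Q.1 = P.1 → PoleLE Q.1 0 s) → PoleLE P.1 (E P) (φ s) := by
  have hne : ∀ {V : X.Opens} {x : X}, x ∈ V → Nonempty (f ⁻¹ᵁ V : Y.Opens) := fun {V x} hx =>
    ⟨⟨genericPoint Y, (apply_genericPoint_specializes f x).mem_open V.isOpen hx⟩⟩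
  have key : ∀ (P : PrimeDivisor X) {V : X.Opens} (hV : IsAffineOpen V) (hPV : P.1 ∈ V)
      [Nonempty V] [Nonempty (f ⁻¹ᵁ V : Y.Opens)] (b : Γ(X, V)), b ≠ 0 →
      (∀ a : Γ(Y, f ⁻¹ᵁ V), ∃ r : Γ(X, V),
        X.germToFunctionField V b * φ (Y.germToFunctionField (f ⁻¹ᵁ V) a) =
          X.germToFunctionField V r) →
      ∀ s : Y.functionField, (∀ Q : PrimeDivisor Y, f Q.1 = P.1 → PoleLE Q.1 0 s) →
        PoleLE P.1 (X.ord (X.germToFunctionField V b) P.1) (φ s) := by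
    intro P V hV hPV _ _ b hb hbφ s hs
    obtain ⟨t, a, ht, hta⟩ := exists_mul_eq_germ_of_forall_stalk f hV hPV s fun y hy =>
      PrimeDivisor.poleLE_zero_iff ⟨y, coheight_eq_one_of_isFinite f P hy⟩ |>.1
        (hs ⟨y, coheight_eq_one_of_isFinite f P hy⟩ hy)
    obtain ⟨r, hr⟩ := hbφ a
    rw [← hta, ← functionFieldMap_germ, hφ] at hr
    have hb0 : X.germToFunctionField V b ≠ 0 :=
      (map_ne_zero_iff _ (X.germToFunctionField_injective V)).2 hb
    have ht0 := P.ord_algebraMap_isUnit ht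
    have htn := (map_ne_zero_iff _ (IsFractionRing.injective _ X.functionField)).2 ht.ne_zero
    rw [Scheme.algebraMap_germ_eq_germToFunctionField] at ht0 htn
    have h := poleLE_germ hPV r
    rw [← hr, ← zpow_one (X.germToFunctionField V b), P.poleLE_zpow_mul_iff hb0,
      ← zpow_one (X.germToFunctionField V t), P.poleLE_zpow_mul_iff htn, ht0] at h
    exact h.mono (by omega)
  have haff : ∀ x : X, ∃ V : X.Opens, IsAffineOpen V ∧ x ∈ V := fun x => by
    obtain ⟨_, ⟨V, hV, rfl⟩, hxV, -⟩ := X.isBasis_affineOpens.exists_subset_of_mem_open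
      (Set.mem_univ x) isOpen_univ
    exact ⟨V, hV, hxV⟩
  have hpt : ∀ P : PrimeDivisor X, ∃ n : ℤ, 0 ≤ n ∧ ∀ s : Y.functionField,
      (∀ Q : PrimeDivisor Y, f Q.1 = P.1 → PoleLE Q.1 0 s) → PoleLE P.1 n (φ s) := by
    intro P
    obtain ⟨V, hV, hPV⟩ := haff P.1
    have := hne hPV
    have : Nonempty V := ⟨⟨_, hPV⟩⟩
    obtain ⟨b, hb, hbφ⟩ := exists_common_denominator f φ hφ hV
    exact ⟨max 0 (X.ord (X.germToFunctionField V b) P.1), le_max_left _ _,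
      fun s hs => (key P hV hPV b hb hbφ s hs).mono (le_max_right _ _)⟩
  choose n hn hnφ using hpt
  obtain ⟨V, hV, hxV⟩ := haff (genericPoint X)
  have := hne hxV
  have : Nonempty V := ⟨⟨_, hxV⟩⟩
  obtain ⟨b, hb, hbφ⟩ := exists_common_denominator f φ hφ hV
  have hU : Nonempty (X.basicOpen b) := ⟨⟨genericPoint X, by
    rw [Scheme.mem_basicOpen X b _ hxV, isUnit_iff_ne_zero]
    exact (map_ne_zero_iff _ (X.germToFunctionField_injective V)).2 hb⟩⟩
  classical
  let E : WeilDivisor X := Finsupp.ofSupportFinite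
    (fun P => if P.1 ∈ X.basicOpen b then 0 else n P)
    ((finite_primeDivisor_notMem (X.basicOpen b)).subset fun P hP hPb => hP (if_pos hPb))
  refine ⟨E, fun P => ?_, fun P s hs => ?_⟩
  · change (0 : ℤ) ≤ if P.1 ∈ X.basicOpen b then 0 else n P
    split_ifs
    exacts [le_rfl, hn P]
  · change PoleLE P.1 (if P.1 ∈ X.basicOpen b then 0 else n P) (φ s)
    split_ifs with hPb
    · have hPV := X.basicOpen_le b hPb
      have h := key P hV hPV b hb hbφ s hs
      have h1 := P.ord_algebraMap_isUnit ((Scheme.mem_basicOpen X b _ hPV).1 hPb)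
      rw [Scheme.algebraMap_germ_eq_germToFunctionField] at h1
      rwa [h1] at h
    · exact hnφ P s hs

variable {φ}

omit [IsFinite f] in
include hφ in
/-- Local form of the projection formula at the prime divisors of the base. -/
theorem poleLE_of_pullback_bound [IsLocallyNoetherian X] [IsNormalScheme X]
    {P : PrimeDivisor X} {d : ℤ}
    (hE : ∀ s : Y.functionField,
      (∀ Q : PrimeDivisor Y, f Q.1 = P.1 → PoleLE Q.1 0 s) → PoleLE P.1 d (φ s))
    (n : ℤ) (s : Y.functionField)
    (hs : ∀ Q : PrimeDivisor Y, f Q.1 = P.1 → PoleLE Q.1 (ramificationIndex f Q.1 * n) s) :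
    PoleLE P.1 (d + n) (φ s) := by
  have := isDiscreteValuationRing_stalk P.2
  obtain ⟨ϖ, hϖ⟩ := IsDiscreteValuationRing.exists_irreducible (X.presheaf.stalk P.1)
  let π := algebraMap (X.presheaf.stalk P.1) X.functionField ϖ
  have hπ : π ≠ 0 := (map_ne_zero_iff _ (IsFractionRing.injective _ _)).2 hϖ.ne_zero
  have hπ1 : X.ord π P.1 = 1 := P.ord_algebraMap_irreducible hϖ
  -- Multiplying by $\pi^n$, for a uniformizer $\pi$ of the base, turns the bound $r_Q n$ on poles
  -- into regularity; linearity takes $\pi^n$ out of `φ`.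
  have h := hE (functionFieldMap f (π ^ n) * s) fun Q hQ => by
    rw [map_zpow₀, Q.poleLE_zpow_mul_iff ((map_ne_zero_iff _ (functionFieldMap f).injective).2 hπ)]
    refine (hs Q hQ).mono (le_of_eq ?_)
    obtain ⟨x, hx⟩ := P
    obtain rfl : f Q.1 = x := hQ
    rw [ord_functionFieldMap_irreducible f Q hx hϖ]
    ring
  rw [hφ, P.poleLE_zpow_mul_iff hπ, hπ1, mul_one] at h
  exact h

end FiniteBounds

/-! ### The Frobenius as a finite cover -/

section FrobeniusCover

variable {p : ℕ} [Fact p.Prime] (hX : HasCharP X p)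

theorem IsFFinite.isFinite_absoluteFrobenius {hX : HasCharP X p} (h : IsFFinite p hX) (e : ℕ) :
    IsFinite (absoluteFrobenius p hX e) := by
  rw [isFinite_iff]
  refine ⟨⟨fun U hU => hU⟩, fun U hU => ?_⟩
  change (frobeniusRingHom p (hX.natCast_eq_zero U) e).Finite
  have h1 : (frobeniusRingHom p (hX.natCast_eq_zero U) 1).Finite := h.finite_app U hU
  induction e with
  | zero =>
    convert RingHom.Finite.id Γ(X, U)
    refine RingHom.ext fun a => ?_
    exact pow_one a
  | succ e ih =>
    convert h1.comp ih
    refine RingHom.ext fun a => ?_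
    change a ^ p ^ (e + 1) = (a ^ p ^ e) ^ p ^ 1
    rw [← pow_mul, ← pow_add]

theorem isDominant_absoluteFrobenius (e : ℕ) : IsDominant (absoluteFrobenius p hX e) :=
  ⟨Function.Surjective.denseRange fun x => ⟨x, rfl⟩⟩

theorem stalkMap_absoluteFrobenius (e : ℕ) (x : X) (a : X.presheaf.stalk x) :
    (absoluteFrobenius p hX e).stalkMap x a = a ^ p ^ e := by
  obtain ⟨U, hU, r, rfl⟩ := X.presheaf.exists_germ_eq a
  refine ((absoluteFrobenius p hX e).germ_stalkMap_apply U x hU r).trans ?_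
  exact map_pow (X.presheaf.germ U x hU).hom r (p ^ e)

theorem ramificationIndex_absoluteFrobenius [IsIntegral X] [IsLocallyNoetherian X]
    [IsNormalScheme X] (e : ℕ) (P : PrimeDivisor X) :
    ramificationIndex (absoluteFrobenius p hX e) P.1 = p ^ e := by
  have := isDiscreteValuationRing_stalk P.2
  obtain ⟨ϖ, hϖ⟩ := IsDiscreteValuationRing.exists_irreducible (X.presheaf.stalk P.1)
  have h1 : (IsLocalRing.maximalIdeal (X.presheaf.stalk (absoluteFrobenius p hX e P.1))).map
      ((absoluteFrobenius p hX e).stalkMap P.1).hom = Ideal.span {ϖ ^ p ^ e} := by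
    refine (congrArg (Ideal.map _) hϖ.maximalIdeal_eq).trans ((Ideal.map_span _ _).trans ?_)
    rw [Set.image_singleton]
    exact congrArg (fun a => Ideal.span {a}) (stalkMap_absoluteFrobenius hX e P.1 ϖ)
  rw [ramificationIndex, h1]
  change (Ring.ord (X.presheaf.stalk P.1) (ϖ ^ p ^ e)).toNat = _
  rw [Ring.ord_pow (mem_nonZeroDivisors_of_ne_zero hϖ.ne_zero), Ring.ord_of_irreducible hϖ]
  simp

end FrobeniusCover

theorem natCast_functionField_eq_zero [IsIntegral X] {p : ℕ} (hX : HasCharP X p) :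
    (p : X.functionField) = 0 := by
  have h := congrArg (X.presheaf.germ ⊤ (genericPoint X) trivial).hom hX
  rwa [map_natCast, map_zero] at h

/-- With a uniformizer $\pi$ at $P$, multiply $s$ by $\pi^{mp^e}$ to reduce to the bound `A P`. That
bound spreads to a neighbourhood of $P$, where `ψ` gives a function, and $\pi^{mp^e}$ leaves `ψ` as
$\pi^m$. -/
theorem NaturalMapSplits.exists_poleLE_map [IsIntegral X] [IsNoetherian X] [IsNormalScheme X]
    {p : ℕ} [Fact p.Prime] {hX : HasCharP X p} {e : ℕ} {A : WeilDivisor X}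
    (h : NaturalMapSplits (absoluteFrobenius p hX e) A) :
    ∃ ψ : X.functionField →+ X.functionField, ψ 1 = 1 ∧
      (∀ k s, ψ (k ^ p ^ e * s) = k * ψ s) ∧
      ∀ (P : PrimeDivisor X) (m : ℤ) (s : X.functionField),
        PoleLE P.1 (A P + (p ^ e : ℕ) * m) s → PoleLE P.1 m (ψ s) := by
  obtain ⟨hA, -⟩ := id h
  obtain ⟨ψ, h1, hψ, hψA⟩ := h.exists_function
  refine ⟨ψ, h1, hψ, fun P m s hs => ?_⟩
  have := isDiscreteValuationRing_stalk P.2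
  obtain ⟨ϖ, hϖ⟩ := IsDiscreteValuationRing.exists_irreducible (X.presheaf.stalk P.1)
  let π := algebraMap (X.presheaf.stalk P.1) X.functionField ϖ
  have hπ : π ≠ 0 := (map_ne_zero_iff _ (IsFractionRing.injective _ _)).2 hϖ.ne_zero
  have hπ1 : X.ord π P.1 = 1 := P.ord_algebraMap_irreducible hϖ
  have h2 : PoleLE P.1 (A P) ((π ^ m) ^ p ^ e * s) := by
    rw [← zpow_natCast, ← zpow_mul, P.poleLE_zpow_mul_iff hπ, hπ1]
    exact hs.mono (le_of_eq (by ring))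
  obtain ⟨U, hPU, hU⟩ := exists_open_poleLE hA P h2
  have : Nonempty U := ⟨⟨_, hPU⟩⟩
  obtain ⟨r, hr⟩ := hψA U _ hU
  rw [hψ] at hr
  have h3 := poleLE_germ hPU r
  rw [← hr, P.poleLE_zpow_mul_iff hπ, hπ1] at h3
  exact h3.mono (by omega)

/-! ### Pullback and rounding -/

theorem QDivisor.pullback_apply (f : Y ⟶ X) [IsFinite f] (Δ : QDivisor X) {Q : PrimeDivisor Y}
    {P : PrimeDivisor X} (h : f Q.1 = P.1) :
    QDivisor.pullback f Δ Q = ramificationIndex f Q.1 * Δ P := by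
  obtain ⟨x, hx⟩ := P
  obtain rfl : f Q.1 = x := h
  exact dif_pos hx

theorem QDivisor.floor_pullback_nonneg (f : Y ⟶ X) [IsFinite f] {Δ : QDivisor X} (hΔ : 0 ≤ Δ) :
    0 ≤ QDivisor.floor (QDivisor.pullback f Δ) := by
  intro Q
  change 0 ≤ ⌊pullbackCoeff f Δ Q⌋
  refine Int.floor_nonneg.2 ?_
  unfold pullbackCoeff
  split_ifs with h
  · exact mul_nonneg (Nat.cast_nonneg _) (hΔ _)
  · exact le_rfl

theorem QDivisor.ceil_nonneg {Δ : QDivisor X} (hΔ : 0 ≤ Δ) : 0 ≤ QDivisor.ceil Δ :=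
  fun P => Int.ceil_nonneg (α := ℚ) (hΔ P)

/-! ### The two implications -/

section Main

variable [IsIntegral X] [IsNormalScheme X] {p : ℕ} [hp : Fact p.Prime] {hX : HasCharP X p}

omit [IsNormalScheme X] in
theorem NaturalMapSplits.mono [IsIntegral Y] [IsLocallyNoetherian Y]
    [IsNormalScheme Y] {f : Y ⟶ X} [IsDominant f] {E E' : WeilDivisor Y}
    (h : NaturalMapSplits f E') (hE : 0 ≤ E) (hEE' : E ≤ E') : NaturalMapSplits f E :=
  .of_transfer f f hE (AddMonoidHom.id _) rfl (fun _ _ _ _ _ => rfl)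
    (fun P _ hs => (hs P rfl).mono (hEE' P)) h

theorem IsStronglyGloballyPlusRegular.isGloballyFRegular [IsLocallyNoetherian X]
    (hF : IsFFinite p hX) {Δ : QDivisor X} (hΔ : 0 ≤ Δ) (h : IsStronglyGloballyPlusRegular Δ) :
    IsGloballyFRegular p hX Δ := by
  intro D hD
  -- The summand $\lceil\Delta\rceil$ pays for rounding up $(p^e-1)\Delta$.
  obtain ⟨ε, hε, hreg⟩ := h (D + QDivisor.ceil Δ) (add_nonneg hD (QDivisor.ceil_nonneg hΔ))
  obtain ⟨n, hn⟩ := pow_unbounded_of_one_lt (1 / ε) (show (1 : ℚ) < p by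
    exact_mod_cast hp.out.one_lt)
  let e := n + 1
  have hpe : 1 ≤ (p : ℚ) ^ e * ε := by
    have h1 : (p : ℚ) ^ n ≤ (p : ℚ) ^ e :=
      pow_le_pow_right₀ (by exact_mod_cast hp.out.one_lt.le) (Nat.le_succ n)
    rw [← div_le_iff₀ hε]
    exact hn.le.trans h1
  have hfin := hF.isFinite_absoluteFrobenius e
  have hdom := isDominant_absoluteFrobenius hX e
  have hΓ := hreg X (absoluteFrobenius p hX e)
  have hq1 : (1 : ℚ) ≤ (p : ℚ) ^ e := one_le_pow₀ (by exact_mod_cast hp.out.one_lt.le)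
  refine ⟨e, Nat.succ_pos n, hΓ.mono ?_ ?_⟩
  · refine add_nonneg (QDivisor.ceil_nonneg fun P => ?_) hD
    exact mul_nonneg (sub_nonneg.2 hq1) (hΔ P)
  · intro P
    have h1 := QDivisor.pullback_apply (absoluteFrobenius p hX e)
      (Δ + ε • WeilDivisor.toQ (D + QDivisor.ceil Δ)) (Q := P) (P := P) rfl
    rw [ramificationIndex_absoluteFrobenius] at h1
    change _ ≤ ⌊QDivisor.pullback (absoluteFrobenius p hX e) _ P⌋
    rw [h1, Int.le_floor]
    change ((⌈((p : ℚ) ^ e - 1) * Δ P⌉ + D P : ℤ) : ℚ) ≤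
      ((p ^ e : ℕ) : ℚ) * (Δ P + ε * ((D P + ⌈Δ P⌉ : ℤ) : ℚ))
    have hδ : 0 ≤ Δ P := hΔ P
    have hD' : 0 ≤ ((D P : ℤ) : ℚ) := by exact_mod_cast hD P
    -- Rounding up costs less than $1$, which is at most $\lceil\Delta\rceil$ where $\Delta>0$;
    -- where $\Delta=0$ nothing is rounded.
    have hc : (⌈((p : ℚ) ^ e - 1) * Δ P⌉ : ℚ) ≤ ((p : ℚ) ^ e - 1) * Δ P + ⌈Δ P⌉ := by
      rcases hδ.eq_or_lt with h0 | h0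
      · simp [← h0]
      · have h2 : (1 : ℚ) ≤ ⌈Δ P⌉ := by exact_mod_cast Int.one_le_ceil_iff.2 h0
        linarith [Int.ceil_lt_add_one (((p : ℚ) ^ e - 1) * Δ P)]
    have hc0 : (0 : ℚ) ≤ ⌈Δ P⌉ := by exact_mod_cast Int.ceil_nonneg hδ
    push_cast
    nlinarith [mul_le_mul_of_nonneg_right hpe (add_nonneg hD' hc0)]

theorem IsGloballyFRegular.isStronglyGloballyPlusRegular [IsNoetherian X] {Δ : QDivisor X}
    (hΔ : 0 ≤ Δ) (h : IsGloballyFRegular p hX Δ) : IsStronglyGloballyPlusRegular Δ := by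
  intro D hD
  obtain ⟨e₀, -, h₀⟩ := h D hD
  have hq0 : (0 : ℚ) < (p : ℚ) ^ e₀ := pow_pos (by exact_mod_cast hp.out.pos) _
  refine ⟨((p : ℚ) ^ e₀)⁻¹, inv_pos.2 hq0, ?_⟩
  intro Y _ _ _ f _ _
  obtain ⟨φ, hφ1, hφ⟩ := exists_linear_retraction_functionFieldMap f
  obtain ⟨E, hE, hφE⟩ := exists_divisor_bound f φ hφ
  -- `E` absorbs the poles created by `φ`, and $\lceil\Delta\rceil$ the missing $\Delta$ in
  -- $(p^{e_1}-1)\Delta$.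
  obtain ⟨e₁, -, h₁⟩ := h (QDivisor.ceil Δ + E) (add_nonneg (QDivisor.ceil_nonneg hΔ) hE)
  obtain ⟨ψ, hψ1, hψ, hψA⟩ := h₁.exists_poleLE_map
  have hYp : (p : Y.functionField) = 0 := by
    have h := congrArg (functionFieldMap f) (natCast_functionField_eq_zero hX)
    rwa [map_natCast, map_zero] at h
  -- `ψ` undoes $e_1$ of the $e_0+e_1$ Frobenius powers, so `θ` is linear over $\mathcal{O}_X$
  -- acting on the target through $F^{e_0}$.
  let θ : Y.functionField →+ X.functionField :=
    ψ.comp (φ.comp (frobeniusRingHom p hYp (e₀ + e₁)).toAddMonoidHom)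
  have hθ : ∀ s, θ s = ψ (φ (s ^ p ^ (e₀ + e₁))) := fun _ => rfl
  have hdom := isDominant_absoluteFrobenius hX e₀
  refine NaturalMapSplits.of_transfer f (absoluteFrobenius p hX e₀)
    (QDivisor.floor_pullback_nonneg f ?_) θ ?_ ?_ ?_ h₀
  · intro P
    have hD' : 0 ≤ ((D P : ℤ) : ℚ) := by exact_mod_cast hD P
    exact add_nonneg (hΔ P) (mul_nonneg (inv_pos.2 hq0).le hD')
  · rw [hθ, one_pow, hφ1, hψ1]
  · intro U hY hZ r s
    have hUX : Nonempty U := ⟨⟨_, hZ⟩⟩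
    have hUY : Nonempty (f ⁻¹ᵁ U : Y.Opens) := ⟨⟨_, hY⟩⟩
    have h1 : Y.presheaf.germ _ _ hY (f.app U r) =
        functionFieldMap f (X.germToFunctionField U r) := (functionFieldMap_germ f r).symm
    have h2 : X.presheaf.germ _ _ hZ ((absoluteFrobenius p hX e₀).app U r) =
        X.germToFunctionField U r ^ p ^ e₀ := map_pow (X.germToFunctionField U).hom r _
    rw [h1, h2, hθ, hθ, mul_pow, ← map_pow, hφ, pow_add, pow_mul, hψ]
  · intro P s hs
    rw [hθ]
    refine hψA P _ _ ?_
    let Γ : ℚ := Δ P + ((p : ℚ) ^ e₀)⁻¹ * (D P : ℚ)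
    have hbound := poleLE_of_pullback_bound f hφ (P := P) (hφE P) ⌈(p : ℚ) ^ (e₀ + e₁) * Γ⌉
      (s ^ p ^ (e₀ + e₁)) fun Q hQ => by
        refine ((hs Q hQ).pow _).mono ?_
        change ((p ^ (e₀ + e₁) : ℕ) : ℤ) * ⌊QDivisor.pullback f _ Q⌋ ≤ _
        rw [QDivisor.pullback_apply f _ hQ]
        change ((p ^ (e₀ + e₁) : ℕ) : ℤ) * ⌊(ramificationIndex f Q.1 : ℚ) * Γ⌋ ≤ _
        have hq : (0 : ℚ) ≤ (p : ℚ) ^ (e₀ + e₁) := by positivity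
        have h1 := mul_le_mul_of_nonneg_left
          (Int.floor_le ((ramificationIndex f Q.1 : ℚ) * Γ)) hq
        have h2 := mul_le_mul_of_nonneg_left (Int.le_ceil ((p : ℚ) ^ (e₀ + e₁) * Γ))
          (Nat.cast_nonneg (α := ℚ) (ramificationIndex f Q.1))
        -- With $q=p^{e_0+e_1}$ and ramification index $r$: $q\lfloor r\Gamma\rfloor\le qr\Gamma\le
        -- r\lceil q\Gamma\rceil$, the form required for `poleLE_of_pullback_bound`.
        have h3 : (p : ℚ) ^ (e₀ + e₁) * (⌊(ramificationIndex f Q.1 : ℚ) * Γ⌋ : ℚ) ≤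
            (ramificationIndex f Q.1 : ℚ) * (⌈(p : ℚ) ^ (e₀ + e₁) * Γ⌉ : ℚ) := by linarith
        exact_mod_cast h3
    refine hbound.mono ?_
    change E P + ⌈(p : ℚ) ^ (e₀ + e₁) * Γ⌉ ≤
      (⌈((p : ℚ) ^ e₁ - 1) * Δ P⌉ + (⌈Δ P⌉ + E P)) +
        ((p ^ e₁ : ℕ) : ℤ) * (⌈((p : ℚ) ^ e₀ - 1) * Δ P⌉ + D P)
    -- The right side is an integer, so the round-up can be dropped. What remains is
    -- $(p^{e_1}-1)\Delta+\Delta+p^{e_1}(p^{e_0}-1)\Delta=p^{e_0+e_1}\Delta$, with equal terms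
    -- $p^{e_1}D$ on both sides.
    rw [← le_sub_iff_add_le', Int.ceil_le]
    have h1 := Int.le_ceil (((p : ℚ) ^ e₁ - 1) * Δ P)
    have h2 := Int.le_ceil (Δ P)
    have h3 := mul_le_mul_of_nonneg_left (Int.le_ceil (((p : ℚ) ^ e₀ - 1) * Δ P))
      (show (0 : ℚ) ≤ (p : ℚ) ^ e₁ by positivity)
    have h4 : (p : ℚ) ^ (e₀ + e₁) * Γ =
        (p : ℚ) ^ e₀ * (p : ℚ) ^ e₁ * Δ P + (p : ℚ) ^ e₁ * (D P : ℚ) := by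
      simp only [Γ, pow_add]
      field_simp
    rw [h4]
    push_cast
    linarith

end Main

end PlusRegular

end

theorem mainTheorem8 {k : Type u} [Field k] (p : ℕ) [Fact p.Prime] [CharP k p]
    (X : Scheme.{u}) [IsIntegral X] [IsLocallyNoetherian X] [PlusRegular.IsNormalScheme X]
    (s : X ⟶ Spec (CommRingCat.of k)) [IsSeparated s] [LocallyOfFiniteType s] [QuasiCompact s]
    (hF : PlusRegular.IsFFinite p (PlusRegular.HasCharP.of_hom_spec p s))
    (Δ : PlusRegular.QDivisor X) (hΔ : 0 ≤ Δ) :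
    PlusRegular.IsGloballyFRegular p (PlusRegular.HasCharP.of_hom_spec p s) Δ ↔
      PlusRegular.IsStronglyGloballyPlusRegular Δ := by
  have : CompactSpace X := QuasiCompact.compactSpace_of_compactSpace s
  have : IsNoetherian X := {}
  exact ⟨fun h => h.isStronglyGloballyPlusRegular hΔ, fun h => h.isGloballyFRegular hF hΔ⟩
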